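/- **Theorem (Universality for tame uniform-subclass sources).** Binary trees are ordered rooted trees in which every node has a possibly empty left and a possibly empty right subtree; $\Lambda$ is the empty tree, $|t|$ the number of nodes of $t$, $t[v]$ the fringe subtree of $t$ rooted at the node $v$, and $t_\ell[v]$, $t_r[v]$ the left and right subtree of $v$. For a property $P$ of binary trees let $\mathcal T_n(P)$ be the set of binary trees of size $n$ that have property $P$ (where $\Lambda$ is always included in $\mathcal T_0(P)$). The uniform-subclass source for $P$ assigns to a binary tree $t$ of size $n$ the probability $\mathbb P[t]=1/|\mathcal T_n(P)|$ if $t\in\mathcal T_n(P)$, and $\mathbb P[t]=0$ otherwise. The source is called *tame* if it is 1. *fringe-hereditary*: every fringe subtree of a tree in $\mathcal T(P)=\bigcup_n\mathcal T_n(P)$ is in $\mathcal T(P)$; 2. *worst-case fringe-dominated*: for some function $B(n)=\Theta(\log n)$, the number of nodes $v$ of $t$ with $|t[v]|\ge B(n)$ is $o(n/\log B(n))$, uniformly over $t\in\mathcal T_n(P)$; 3. *log-linear*: $\lg|\mathcal T_n(P)|=cn+o(n)$ for a constant $c>0$; 4. *heavy-twigged*: for some function $B(n)=\Theta(\log n)$,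 if $v$ is a node of $t\in\mathcal T_n(P)$ with $|t[v]|\ge B(n)$, then $|t_\ell[v]|$ and $|t_r[v]|$ are $\omega(1)$, uniformly. The *hypersuccinct code* $\mathsf H$ maps a binary tree $t$ of size $n$ to a bit string as follows. Decompose $t$ by the Farzan–Munro algorithm with parameter $B=\max(1,\lceil\frac18\lg n\rceil)$ into connected subtrees (micro trees). The algorithm works bottom-up and forms, for every node $v$, a component that contains $v$; components are *active* until they are declared *permanent*. If both child subtrees of $v$ have at least $B$ nodes, then $\{v\}$ and the components of both children are declared permanent. Otherwise the component of $v$ consists of $v$ and those components of its children that are still active, and it is declared permanent as soon as it has at least $B$ nodes. Finally the component of the root of $t$ is declared permanent. The permanent components are the micro trees. Contracting each of them to a node gives the top tier $\Upsilon$, again a binary tree; $\mu_1,\dots,\mu_m$ are the shapes of the micro trees in preorder of $\Upsilon$. The *portal* to a child micro tree is the null pointer left in its parent micro tree when the child is cut off. Let $\mathit{BP}$ denote the balanced-parenthesis encoding of binary trees, given by $\mathit{BP}(\Lambda)=\varepsilon$ and $\mathit{BP}(t)=(\,\mathit{BP}(t_\ell)\,)\,\mathit{BP}(t_r)$, and $\gamma$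 the Elias gamma code. Let $C$ be a Huffman code for the string $\mu_1\cdots\mu_m$ (ties broken arbitrarily), and let $\bar C(s)=0\cdot\gamma(|s|+1)\cdot\mathit{BP}(s)$ if $|C(s)|>2|s|+2\lfloor\lg(|s|+1)\rfloor$, and $\bar C(s)=1\cdot C(s)$ otherwise. Then $\mathsf H(t)$ is the concatenation of $\gamma(n+1)$, $\gamma(m+1)$, $\mathit{BP}(\Upsilon)$, a table of $\bar C$ (the number plus one of different shapes in gamma code, then for each shape $s$ the string $\gamma(|\bar C(s)|)\cdot\bar C(s)\cdot\gamma(|s|)\cdot\mathit{BP}(s)$), the codewords $\bar C(\mu_1)\cdots\bar C(\mu_m)$, and for each micro tree two integers of $\lceil\lg(\lceil\frac14\lg n\rceil+1)\rceil$ bits each, which give the positions of its left and right portal among its null pointers ($0$ if there is none). *Claim.* For every tame uniform-subclass source there is a function $\varepsilon(n)=o(n)$, depending only on $P$, such that for every binary tree $t$ of size $n$ with $\mathbb P[t]>0$ $$|\mathsf H(t)|\;\le\;\lg\frac1{\mathbb P[t]}+\varepsilon(n).$$ Moreover, the following two uniform-subclass sources are tame, so that the bound applies to them: - AVL trees (binary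 trees in which, at every node, the heights of the two subtrees differ by at most one); - shapes of left-leaning red-black trees (binary trees whose edges, including the edges to null pointers, which are black, can be coloured red and black such that all paths from the root to a null pointer have the same number of black edges, no two consecutive edges on such a path are red, and a node with exactly one red child edge has it on the left). -/

import Mathlib

/-! Binary trees are Mathlib's `BinaryTree Unit`: `nil` is the empty tree, `numNodes` the size and
`height` the height, with `height nil = 0`.  Bit strings are `List Bool`. -/

namespace Hypersuccinct

open Filter Asymptotics BinaryTree

/-! ### Fringe subtrees -/

/-- The fringe subtrees `t[v]` of `t`, one entry for every node `v` of `t`, in preorder. -/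
def fringeSubtrees {α : Type*} : BinaryTree α → List (BinaryTree α)
  | .nil => []
  | .node a l r => .node a l r :: (fringeSubtrees l ++ fringeSubtrees r)

/-- `n_{≥ b}(t)`: the number of nodes `v` of `t` with `|t[v]| ≥ b`. -/
noncomputable def numHeavy (b : ℝ) (t : BinaryTree Unit) : ℕ :=
  open Classical in (fringeSubtrees t).countP (fun s => b ≤ (s.numNodes : ℝ))

/-! ### Elementary codes -/

/-- Balanced-parenthesis encoding: `true` is an opening and `false` a closing parenthesis. -/
def bp {α : Type*} : BinaryTree α → List Bool
  | .nil => []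
  | .node _ l r => true :: (bp l ++ false :: bp r)

/-- Elias gamma code of `k ≥ 1`: `⌊lg k⌋` zeros, then the binary representation of `k`,
most significant bit first. -/
def eliasGamma (k : ℕ) : List Bool :=
  List.replicate (k.bits.length - 1) false ++ k.bits.reverse

/-- The integer `k` written with `w` bits, most significant bit first. -/
def fixedWidth (w k : ℕ) : List Bool :=
  (List.range w).map (fun i => k.testBit (w - 1 - i))

/-! ### The Farzan-Munro decomposition of a binary tree

A decomposition of a binary tree into connected subtrees (micro trees) is given by labelling each
node by `true` if it is the root of a completed micro tree, and by `false` if it lies in the same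
micro tree as its parent (or in a component that is still active). -/

/-- Number of nodes of the active component at the root (`0` if the component at the root is
already permanent). -/
def activeSize : BinaryTree Bool → ℕ
  | .nil => 0
  | .node true _ _ => 0
  | .node false l r => activeSize l + activeSize r + 1

/-- Declare the component at the root permanent. -/
def close : BinaryTree Bool → BinaryTree Bool
  | .nil => .nil
  | .node _ l r => .node true l r

/-- The recursive procedure of the Farzan-Munro algorithm with parameter `B`.  A node is heavy if
its fringe subtree has at least `B` nodes.  At a node `v`:
* if both children are heavy, their components and the component `{v}` are declared permanent;
* otherwise `v` is joined with the active components of its children (a component which is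
  already permanent stays untouched), and the result is declared permanent once it has at least
  `B` nodes. -/
def coverRec (B : ℕ) : BinaryTree Unit → BinaryTree Bool
  | .nil => .nil
  | .node _ l r =>
    if B ≤ l.numNodes ∧ B ≤ r.numNodes then
      .node true (close (coverRec B l)) (close (coverRec B r))
    else
      let c := BinaryTree.node false (coverRec B l) (coverRec B r)
      if B ≤ activeSize c then close c else c

/-- The Farzan-Munro decomposition: the component left over at the root becomes permanent too. -/
def cover (B : ℕ) (t : BinaryTree Unit) : BinaryTree Bool :=
  close (coverRec B t)

/-- The part of a labelled tree that lies above all micro-tree roots; these become null pointers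
(portals). -/
def localPart : BinaryTree Bool → BinaryTree Unit
  | .nil => .nil
  | .node true _ _ => .nil
  | .node false l r => .node () (localPart l) (localPart r)

/-- The rank, in left-to-right order, of the first portal among all null pointers of
`localPart c`, if there is a portal. -/
def portalRank : BinaryTree Bool → Option ℕ
  | .nil => none
  | .node true _ _ => some 0
  | .node false l r =>
    match portalRank l with
    | some k => some k
    | none => (portalRank r).map (fun k => (localPart l).numLeaves + k)

/-- A micro tree: its local shape, and the ranks among its null pointers of the portals to its
left and its right child micro tree (in the left resp. right subtree of its root). -/
structure Micro where
  shape : BinaryTree Unit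
  leftPortal : Option ℕ
  rightPortal : Option ℕ

/-- The top tier: contract each micro tree to a node, labelled here by the micro tree.  The left
(right) child of a micro tree in the top tier is the micro tree reached by the portal in the left
(right) subtree of its root.  (In a Farzan-Munro decomposition there is at most one such portal
on either side.)  On a tree whose root is not a micro-tree root, this is the top tier below the
first portal. -/
def topTier : BinaryTree Bool → BinaryTree Micro
  | .nil => .nil
  | .node true l r =>
    .node
      { shape := .node () (localPart l) (localPart r)
        leftPortal := portalRank l
        rightPortal := (portalRank r).map (fun k => (localPart l).numLeaves + k) }
      (topTier l) (topTier r)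
  | .node false l r =>
    match topTier l with
    | .nil => topTier r
    | .node m l' r' => .node m l' r'

/-- The labels of a tree in preorder. -/
def preorder {α : Type*} : BinaryTree α → List α
  | .nil => []
  | .node a l r => a :: (preorder l ++ preorder r)

/-! ### Huffman codes -/

/-- Code trees with letters at the leaves. -/
inductive CodeTree (α : Type*) where
  | leaf (a : α) : CodeTree α
  | node (l r : CodeTree α) : CodeTree α

/-- Total weight of the letters of a code tree. -/
def CodeTree.weight {α : Type*} (f : α → ℕ) : CodeTree α → ℕ
  | .leaf a => f a
  | .node l r => l.weight f + r.weight f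

/-- The letters of a code tree. -/
def CodeTree.letters {α : Type*} : CodeTree α → List α
  | .leaf a => [a]
  | .node l r => l.letters ++ r.letters

/-- The codeword of the letter `a`: the path from the root to the leaf `a`. -/
def CodeTree.codeword {α : Type*} [DecidableEq α] : CodeTree α → α → List Bool
  | .leaf _, _ => []
  | .node l r, a => if a ∈ l.letters then false :: l.codeword a else true :: r.codeword a

/-- `HuffmanMerge f S T`: Huffman's algorithm with letter frequencies `f`, started on the forest
`S`, can end with the tree `T`.  In each step two trees `x`, `y` of smallest weight in the forest
(ties broken arbitrarily) are replaced by the tree with subtrees `x` and `y`. -/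
inductive HuffmanMerge {α : Type*} (f : α → ℕ) : Multiset (CodeTree α) → CodeTree α → Prop
  | done (T : CodeTree α) : HuffmanMerge f {T} T
  | merge (S : Multiset (CodeTree α)) (x y T : CodeTree α)
      (hmin : ∀ z ∈ S, x.weight f ≤ z.weight f ∧ y.weight f ≤ z.weight f)
      (h : HuffmanMerge f (CodeTree.node x y ::ₘ S) T) :
      HuffmanMerge f (x ::ₘ y ::ₘ S) T

/-- `C` is a Huffman code for the string `w`: on the letters of `w` it is given by a code tree that
Huffman's algorithm builds from the frequencies of the letters in `w`.  (For the empty string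
there is nothing to encode.) -/
def IsHuffmanCode {α : Type*} [DecidableEq α] (w : List α) (C : α → List Bool) : Prop :=
  w = [] ∨ ∃ T : CodeTree α,
    HuffmanMerge (fun a => w.count a) (w.toFinset.val.map CodeTree.leaf) T ∧
      ∀ a ∈ w, C a = T.codeword a

/-- Huffman's algorithm always ends with a tree. -/
theorem huffmanMerge_total {α : Type*} (f : α → ℕ) (S : Multiset (CodeTree α)) (hS : S ≠ 0) :
    ∃ T, HuffmanMerge f S T := by
  classical
  obtain ⟨k, hk⟩ : ∃ k, S.card = k + 1 :=
    Nat.exists_eq_succ_of_ne_zero (by simpa using hS)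
  induction k generalizing S with
  | zero =>
    obtain ⟨a, rfl⟩ := Multiset.card_eq_one.mp hk
    exact ⟨a, .done a⟩
  | succ k ih =>
    have hmin : ∀ S : Multiset (CodeTree α), S ≠ 0 →
        ∃ x ∈ S, ∀ z ∈ S, x.weight f ≤ z.weight f := by
      intro S hS
      obtain ⟨x, hx, h⟩ := Finset.exists_min_image S.toFinset (fun z => z.weight f)
        (by simpa [Multiset.toFinset_nonempty] using hS)
      exact ⟨x, by simpa using hx, fun z hz => h z (by simpa using hz)⟩
    obtain ⟨x, hx, hx'⟩ := hmin S hS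
    obtain ⟨S₁, rfl⟩ := Multiset.exists_cons_of_mem hx
    have h1 : S₁.card = k + 1 := by simpa using hk
    obtain ⟨y, hy, hy'⟩ := hmin S₁ (by rintro rfl; simp at h1)
    obtain ⟨S₂, rfl⟩ := Multiset.exists_cons_of_mem hy
    obtain ⟨T, hT⟩ := ih (CodeTree.node x y ::ₘ S₂) (by simp) (by simpa using h1)
    exact ⟨T, .merge S₂ x y T (fun z hz => ⟨hx' z (by simp [hz]), hy' z (by simp [hz])⟩) hT⟩

/-- Every string has a Huffman code. -/
theorem exists_isHuffmanCode {α : Type*} [DecidableEq α] (w : List α) :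
    ∃ C, IsHuffmanCode w C := by
  by_cases hw : w = []
  · exact ⟨fun _ => [], .inl hw⟩
  · obtain ⟨T, hT⟩ := huffmanMerge_total (fun a => w.count a)
      (w.toFinset.val.map CodeTree.leaf) (by simpa using hw)
    exact ⟨T.codeword, .inr ⟨T, hT, fun _ _ => rfl⟩⟩

/-- Length-restricted version of a binary-tree code. -/
def lengthRestrict (C : BinaryTree Unit → List Bool) (t : BinaryTree Unit) : List Bool :=
  if 2 * t.numNodes + 2 * Nat.log 2 (t.numNodes + 1) < (C t).length then
    false :: (eliasGamma (t.numNodes + 1) ++ bp t)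
  else
    true :: C t

/-! ### The hypersuccinct code -/

/-- The parameter `B = ⌈lg(n)/8⌉` of the decomposition (at least `1`). -/
noncomputable def blockParam (n : ℕ) : ℕ := max 1 ⌈Real.logb 2 n / 8⌉₊

/-- The bound `μ = ⌈lg(n)/4⌉` on the size of micro trees. -/
noncomputable def microBound (n : ℕ) : ℕ := ⌈Real.logb 2 n / 4⌉₊

/-- The top tier of `t` (with its micro trees). -/
noncomputable def tiers (t : BinaryTree Unit) : BinaryTree Micro :=
  topTier (cover (blockParam t.numNodes) t)

/-- The string `μ₁ … μₘ` of shapes of the micro trees of `t`, in preorder of the top tier. -/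
noncomputable def microShapes (t : BinaryTree Unit) : List (BinaryTree Unit) :=
  (preorder (tiers t)).map Micro.shape

/-- The codebook: the number of codewords, then all codewords, each with its length, followed by
the size and the BP sequence of the corresponding tree. -/
def codebook (alphabet : List (BinaryTree Unit)) (C : BinaryTree Unit → List Bool) : List Bool :=
  eliasGamma (alphabet.length + 1) ++
    alphabet.flatMap (fun s =>
      eliasGamma (C s).length ++ C s ++ eliasGamma s.numNodes ++ bp s)

/-- The two portal positions of a micro tree, as integers of `w` bits (`0` if there is no such
portal). -/
def portalBits (w : ℕ) (m : Micro) : List Bool :=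
  fixedWidth w (m.leftPortal.getD 0) ++ fixedWidth w (m.rightPortal.getD 0)

/-- The hypersuccinct encoding of `t`, given a code `C` for the micro-tree shapes: the size `n`
and the number `m` of micro trees (both plus one, as `t` may be empty) in Elias gamma code, the
BP sequence of the top tier, the codebook of the length-restricted code, the length-restricted
codewords of all micro trees, and the portals of all micro trees. -/
noncomputable def encode (C : BinaryTree Unit → List Bool) (t : BinaryTree Unit) : List Bool :=
  eliasGamma (t.numNodes + 1) ++ eliasGamma ((microShapes t).length + 1) ++
    bp (tiers t) ++
    codebook (microShapes t).dedup (lengthRestrict C) ++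
    (microShapes t).flatMap (lengthRestrict C) ++
    (preorder (tiers t)).flatMap (portalBits (Nat.clog 2 (microBound t.numNodes + 1)))

/-- `H` is the hypersuccinct code, for some choice of a Huffman code for the micro trees of each
tree (Huffman codes are unique only up to the breaking of ties). -/
def IsHypersuccinctCode (H : BinaryTree Unit → List Bool) : Prop :=
  ∀ t, ∃ C, IsHuffmanCode (microShapes t) C ∧ H t = encode C t

theorem exists_isHypersuccinctCode : ∃ H, IsHypersuccinctCode H := by
  choose C hC using fun t => exists_isHuffmanCode (microShapes t)
  exact ⟨fun t => encode (C t) t, fun t => ⟨C t, hC t, rfl⟩⟩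

/-! ### Uniform-subclass sources -/

/-- `𝒯_n(P)`: the binary trees of size `n` with property `P`; the empty tree is always included. -/
noncomputable def subclass (P : BinaryTree Unit → Prop) (n : ℕ) : Finset (BinaryTree Unit) :=
  open Classical in (treesOfNumNodesEq n).filter (fun t => t = .nil ∨ P t)

/-- The probability `ℙ[t]` of `t` under the uniform-subclass source for the property `P`. -/
noncomputable def prob (P : BinaryTree Unit → Prop) (t : BinaryTree Unit) : ℝ :=
  open Classical in
  if t ∈ subclass P t.numNodes then ((subclass P t.numNodes).card : ℝ)⁻¹ else 0

/-- Every fringe subtree of a tree in the class belongs to the class. -/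
def FringeHereditary (P : BinaryTree Unit → Prop) : Prop :=
  ∀ n, ∀ t ∈ subclass P n, ∀ s ∈ fringeSubtrees t, s ∈ subclass P s.numNodes

/-- Worst-case fringe-dominated: `n_{≥ B(n)}(t) = o(n / log B(n))`, uniformly for `t ∈ 𝒯_n(P)`,
for some `B(n) = Θ(log n)`. -/
def WorstCaseFringeDominated (P : BinaryTree Unit → Prop) : Prop :=
  ∃ B : ℕ → ℝ, B =Θ[atTop] (fun n : ℕ => Real.log n) ∧
    ∃ g : ℕ → ℝ, g =o[atTop] (fun n : ℕ => (n : ℝ) / Real.log (B n)) ∧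
      ∀ n, ∀ t ∈ subclass P n, (numHeavy (B n) t : ℝ) ≤ g n

/-- Log-linear: `lg |𝒯_n(P)| = c n + o(n)` for a constant `c > 0`. -/
def LogLinear (P : BinaryTree Unit → Prop) : Prop :=
  ∃ c : ℝ, 0 < c ∧
    (fun n : ℕ => Real.logb 2 (subclass P n).card - c * n) =o[atTop] (fun n : ℕ => (n : ℝ))

/-- Heavy-twigged: for some `B(n) = Θ(log n)`, if `v` is a node of `t ∈ 𝒯_n(P)` with
`|t[v]| ≥ B(n)`, then both subtrees of `v` have size `ω(1)`, uniformly. -/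
def HeavyTwigged (P : BinaryTree Unit → Prop) : Prop :=
  ∃ B : ℕ → ℝ, B =Θ[atTop] (fun n : ℕ => Real.log n) ∧
    ∃ w : ℕ → ℝ, Tendsto w atTop atTop ∧
      ∀ n, ∀ t ∈ subclass P n, ∀ s ∈ fringeSubtrees t, B n ≤ (s.numNodes : ℝ) →
        w n ≤ (s.left.numNodes : ℝ) ∧ w n ≤ (s.right.numNodes : ℝ)

/-- Tame uniform-subclass sources. -/
structure Tame (P : BinaryTree Unit → Prop) : Prop where
  fringeHereditary : FringeHereditary P
  worstCaseFringeDominated : WorstCaseFringeDominated P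
  logLinear : LogLinear P
  heavyTwigged : HeavyTwigged P

/-! ### Examples -/

/-- AVL trees: at every node the heights of the two subtrees differ by at most one. -/
def IsAVL (t : BinaryTree Unit) : Prop :=
  ∀ s ∈ fringeSubtrees t, |(s.left.height : ℤ) - (s.right.height : ℤ)| ≤ 1

/-- Is the edge from the parent to the root of this subtree red?  Nodes are labelled by the colour
of the edge from their parent (`true` is red); edges to null pointers are black. -/
def redEdge : BinaryTree Bool → Bool
  | .nil => false
  | .node b _ _ => b

/-- The numbers of black edges on the paths from the root to the null pointers. -/
def blackCounts : BinaryTree Bool → List ℕ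
  | .nil => [0]
  | .node _ l r =>
    (blackCounts l).map (fun k => k + if redEdge l then 0 else 1) ++
      (blackCounts r).map (fun k => k + if redEdge r then 0 else 1)

/-- `t` is the shape of a left-leaning red-black tree: its edges can be coloured red and black
such that all paths from the root to a null pointer have the same number of black edges, no two
consecutive edges on such a path are red, and a node with only one red child edge has it on the
left.  (The edges to the null pointers are black, and the label of the root is irrelevant.) -/
def IsLeftLeaningRedBlack (t : BinaryTree Unit) : Prop :=
  ∃ c : BinaryTree Bool, c.map (fun _ => ()) = t ∧
    (∀ x ∈ blackCounts c, ∀ y ∈ blackCounts c, x = y) ∧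
    (∀ d ∈ fringeSubtrees c,
      (redEdge d.left = true → redEdge d.left.left = false ∧ redEdge d.left.right = false) ∧
      (redEdge d.right = true → redEdge d.right.left = false ∧ redEdge d.right.right = false)) ∧
    (∀ d ∈ fringeSubtrees c, redEdge d.right = true → redEdge d.left = true)

end Hypersuccinct

namespace Hypersuccinct

open Filter Asymptotics BinaryTree

/-! A Huffman code is, in total, no longer than any assignment of lengths satisfying Kraft's
inequality (`IsHuffmanCode.sum_length_le`). It therefore suffices to find admissible lengths for the
micro tree shapes whose sum is at most `lg |𝒯_n(P)| + o(n)`. They come from a subprobability weight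
on shapes, `shapeWeight`, the mean of two weights. `fringeWeight` serves the micro trees that are
whole fringe subtrees: up to a polynomial factor it is uniform on the class at each size, so by
log-linearity it costs `ck + o(k)` bits at size `k`. A micro tree with one portal is a path from its
root to the portal with fringe subtrees hanging off it; `pathWeight` charges the hanging subtrees by
`fringeWeight` and adds two bits per path node.

The error terms must add up to `o(n)`. There are only `O(n/B)` micro trees with `B` about `lg n /
8`, so a constant number of bits for each of them is negligible, and so are the `O(log B)` bits of
the portals; the codebook has `O(n^(5/8))` bits. The path nodes may be far more numerous than the
micro trees, and here heavy-twiggedness enters: a path node has a fringe subtree of at least `B`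
nodes, so the subtree hanging off it has at least `k₀` nodes, for any `k₀` fixed beforehand. Its
cost and the two extra bits then fit into `(c + η)` bits per node, with no additive constant.
`totalCost_coverRec_le` does this accounting.

Both examples are `Balanced`: each child of a root has at least about the square root of the leaves
of the whole tree. This gives heavy twigs, and also few heavy nodes, because `k` heavy nodes leave
`k + 1` disjoint subtrees with many leaves. Log-linearity is an argument in the style of Fekete. The
trees of size `m` split into at most `m + 1` subclasses by height or black height, so the largest
has almost the full exponential rate; joining many of its trees in a balanced way stays in the class
(`BalancedJoin.isAVL`, `BalancedJoin.redBlack`), and two filler trees of consecutive sizes allow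
every large total size (`exists_rate_le`). -/

/-! ### Huffman codes are optimal -/

/-- The weighted external path length of a code tree. -/
def CodeTree.cost {α : Type*} (f : α → ℕ) : CodeTree α → ℕ
  | .leaf _ => 0
  | .node l r => l.cost f + r.cost f + (l.weight f + r.weight f)

/-- Exchanging lengths, an element of smallest weight can be given the greatest length. -/
theorem exists_exchange {β : Type*} (g : β → ℕ) (x : β) (a : ℕ) (R : Multiset (β × ℕ))
    (hmin : ∀ z ∈ R.map Prod.fst, g x ≤ g z) :
    ∃ (a' : ℕ) (R' : Multiset (β × ℕ)), R'.map Prod.fst = R.map Prod.fst ∧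
      a' ::ₘ R'.map Prod.snd = a ::ₘ R.map Prod.snd ∧ (∀ p ∈ R', p.2 ≤ a') ∧
      g x * a' + (R'.map fun p => g p.1 * p.2).sum ≤
        g x * a + (R.map fun p => g p.1 * p.2).sum := by
  classical
  by_cases h : ∀ p ∈ R, p.2 ≤ a
  · exact ⟨a, R, rfl, rfl, h, le_rfl⟩
  push Not at h
  obtain ⟨p₀, hp₀, hlt⟩ := h
  obtain ⟨p, hp, hmax⟩ := Finset.exists_max_image R.toFinset Prod.snd
    ⟨p₀, by simpa using hp₀⟩
  rw [Multiset.mem_toFinset] at hp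
  replace hmax : ∀ z ∈ R, z.2 ≤ p.2 := fun z hz => hmax z (by simpa using hz)
  have hpa : a < p.2 := hlt.trans_le (hmax _ hp₀)
  obtain ⟨R₁, rfl⟩ := Multiset.exists_cons_of_mem hp
  refine ⟨p.2, (p.1, a) ::ₘ R₁, by simp, by simp [Multiset.cons_swap], ?_, ?_⟩
  · intro z hz
    rcases Multiset.mem_cons.1 hz with rfl | hz
    · exact hpa.le
    · exact hmax z (by simp [hz])
  · have h1 : g x ≤ g p.1 := hmin _ (by simp)
    simp only [Multiset.map_cons, Multiset.sum_cons]
    nlinarith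

theorem exists_cons_of_map_fst_eq_cons {β γ : Type*} {M : Multiset (β × γ)} {x : β}
    {S : Multiset β} (h : M.map Prod.fst = x ::ₘ S) :
    ∃ (a : γ) (R : Multiset (β × γ)), M = (x, a) ::ₘ R ∧ R.map Prod.fst = S := by
  have hx : x ∈ M.map Prod.fst := by simp [h]
  obtain ⟨⟨x', a⟩, hp, rfl⟩ := Multiset.mem_map.1 hx
  obtain ⟨R, rfl⟩ := Multiset.exists_cons_of_mem hp
  exact ⟨a, R, rfl, by simpa using h⟩

/-- Kraft sums with lengths at most `b` are multiples of `2^(-b)`. In the Huffman induction this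
turns a strict inequality into a gap of a full unit. -/
theorem exists_nat_sum_half_pow (b : ℕ) (L : Multiset ℕ) (h : ∀ l ∈ L, l ≤ b) :
    ∃ N : ℕ, (L.map fun l => (1 / 2 : ℝ) ^ l).sum * 2 ^ b = N := by
  induction L using Multiset.induction with
  | empty => exact ⟨0, by simp⟩
  | cons l L ih =>
    obtain ⟨N, hN⟩ := ih fun l hl => h l (by simp [hl])
    refine ⟨2 ^ (b - l) + N, ?_⟩
    have hl : l ≤ b := h l (by simp)
    have : (1 / 2 : ℝ) ^ l * 2 ^ b = 2 ^ (b - l) := by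
      rw [one_div, inv_pow, inv_mul_eq_div, div_eq_iff (by positivity), ← pow_add]
      congr 1; omega
    simp only [Multiset.map_cons, Multiset.sum_cons, add_mul, hN, this]
    push_cast; ring

/-- The tree built by Huffman's algorithm has the smallest cost among all assignments of lengths
that satisfy Kraft's inequality. -/
theorem HuffmanMerge.cost_le {α : Type*} {f : α → ℕ} {S : Multiset (CodeTree α)} {T : CodeTree α}
    (h : HuffmanMerge f S T) : ∀ M : Multiset (CodeTree α × ℕ), M.map Prod.fst = S →
      (M.map fun p => (1 / 2 : ℝ) ^ p.2).sum ≤ 1 →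
      T.cost f ≤ (S.map (CodeTree.cost f)).sum + (M.map fun p => p.1.weight f * p.2).sum := by
  induction h with
  | done T => intro M _ _; simp
  | merge S x y T hmin h ih =>
    intro M hM hK
    obtain ⟨a, R₀, rfl, hR₀⟩ := exists_cons_of_map_fst_eq_cons hM
    obtain ⟨b, R, rfl, hR⟩ := exists_cons_of_map_fst_eq_cons hR₀
    -- Two exchanges make the lengths of the two lightest trees at least as large as all others,
    -- without raising the cost or changing the multiset of lengths.
    obtain ⟨a₁, R₁, h1, h1', h1max, h1cost⟩ := exists_exchange (CodeTree.weight f) x a R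
      (fun z hz => (hmin z (hR ▸ hz)).1)
    obtain ⟨b₁, R₂, h2, h2', h2max, h2cost⟩ := exists_exchange (CodeTree.weight f) y b R₁
      (fun z hz => (hmin z (hR ▸ h1 ▸ hz)).2)
    have h2max' : ∀ p ∈ R₂, p.2 ≤ a₁ := by
      intro p hp
      have hb : b₁ ∈ b ::ₘ R₁.map Prod.snd := by rw [← h2']; simp
      rcases Multiset.mem_cons.1 hb with rfl | hb
      · rw [Multiset.cons_inj_right] at h2'
        have : p.2 ∈ R₁.map Prod.snd := by rw [← h2']; exact Multiset.mem_map_of_mem _ hp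
        obtain ⟨q, hq, hqp⟩ := Multiset.mem_map.1 this
        exact hqp ▸ h1max q hq
      · obtain ⟨q, hq, rfl⟩ := Multiset.mem_map.1 hb
        exact (h2max p hp).trans (h1max q hq)
    have hlen : a₁ ::ₘ b₁ ::ₘ R₂.map Prod.snd = a ::ₘ b ::ₘ R.map Prod.snd := by
      rw [h2', Multiset.cons_swap, h1', Multiset.cons_swap]
    have hK' : (1 / 2 : ℝ) ^ a₁ + ((1 / 2 : ℝ) ^ b₁ +
        (R₂.map fun p => (1 / 2 : ℝ) ^ p.2).sum) ≤ 1 := by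
      have := congrArg (fun L : Multiset ℕ => (L.map fun l => (1 / 2 : ℝ) ^ l).sum) hlen
      simp only [Multiset.map_cons, Multiset.sum_cons, Multiset.map_map,
        Function.comp_def] at this hK
      rw [this]; exact hK
    -- The two lengths need not agree, so both are cut down to the smaller one, `m`. Dropping the
    -- other, positive Kraft term leaves `2^(-m) + Σ < 1`; as `Σ` is a multiple of `2^(-m)`, a
    -- second term `2^(-m)` fits as well.
    obtain ⟨m, hm⟩ : ∃ m, m = min a₁ b₁ := ⟨_, rfl⟩
    obtain ⟨N, hN⟩ := exists_nat_sum_half_pow m (R₂.map Prod.snd) (by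
      intro l hl
      obtain ⟨p, hp, rfl⟩ := Multiset.mem_map.1 hl
      exact hm ▸ le_min (h2max' p hp) (h2max p hp))
    simp only [Multiset.map_map, Function.comp_def] at hN
    have hpow : (1 / 2 : ℝ) ^ m * 2 ^ m = 1 := by rw [← mul_pow]; norm_num
    have hN1 : N + 1 < 2 ^ m := by
      have hlt : (1 / 2 : ℝ) ^ m + (R₂.map fun p => (1 / 2 : ℝ) ^ p.2).sum < 1 := by
        have ha : 0 < (1 / 2 : ℝ) ^ a₁ := by positivity
        have hb : 0 < (1 / 2 : ℝ) ^ b₁ := by positivity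
        rcases min_choice a₁ b₁ with h | h <;> rw [hm, h] <;> linarith
      have h2m : (0 : ℝ) < 2 ^ m := by positivity
      have := mul_lt_mul_of_pos_right hlt h2m
      rw [add_mul, hpow, hN] at this
      have h' : ((N + 1 : ℕ) : ℝ) < ((2 ^ m : ℕ) : ℝ) := by push_cast; linarith
      exact_mod_cast h'
    obtain ⟨k, rfl⟩ : ∃ k, m = k + 1 :=
      Nat.exists_eq_succ_of_ne_zero (by rintro rfl; simp at hN1)
    -- The two slots of length `k + 1` merge into one of length `k` for the new tree.
    have hfin := ih ((CodeTree.node x y, k) ::ₘ R₂) (by simp [h2, h1, hR]) (by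
      have h2m : (0 : ℝ) < 2 ^ (k + 1) := by positivity
      simp only [Multiset.map_cons, Multiset.sum_cons]
      rw [← mul_le_mul_iff_left₀ h2m, add_mul, hN, one_mul]
      have : (1 / 2 : ℝ) ^ k * 2 ^ (k + 1) = 2 := by
        rw [pow_succ, ← mul_assoc, ← mul_pow]; norm_num
      rw [this]
      have : 2 + N ≤ 2 ^ (k + 1) := by omega
      exact_mod_cast this)
    simp only [Multiset.map_cons, Multiset.sum_cons, CodeTree.cost, CodeTree.weight] at hfin ⊢
    have ha : k + 1 ≤ a₁ := hm ▸ min_le_left _ _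
    have hb : k + 1 ≤ b₁ := hm ▸ min_le_right _ _
    have ha' := Nat.mul_le_mul_left (x.weight f) ha
    have hb' := Nat.mul_le_mul_left (y.weight f) hb
    rw [mul_add] at ha' hb'
    rw [add_mul] at hfin
    omega

/-- Every merge lengthens the codewords below it by one bit, which costs its weight. Distinctness
matters because `codeword` goes left whenever the letter occurs there. -/
theorem CodeTree.sum_letters_codeword {α : Type*} [DecidableEq α] (f : α → ℕ)
    (T : CodeTree α) (hT : T.letters.Nodup) :
    (T.letters.map fun a => f a * (T.codeword a).length).sum = T.cost f := by
  induction T with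
  | leaf a => simp [letters, codeword, cost]
  | node l r ihl ihr =>
    have hw : ∀ T : CodeTree α, T.weight f = (T.letters.map f).sum := by
      intro T
      induction T with
      | leaf a => simp [weight, letters]
      | node l r ihl ihr => simp [weight, letters, ihl, ihr]
    simp only [letters, List.nodup_append'] at hT
    obtain ⟨hl, hr, hd⟩ := hT
    have e1 : (l.letters.map fun a => f a * ((node l r).codeword a).length) =
        l.letters.map fun a => f a * (l.codeword a).length + f a := by
      refine List.map_congr_left fun a ha => ?_
      simp [codeword, ha, mul_add]
    have e2 : (r.letters.map fun a => f a * ((node l r).codeword a).length) =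
        r.letters.map fun a => f a * (r.codeword a).length + f a := by
      refine List.map_congr_left fun a ha => ?_
      have : a ∉ l.letters := fun h => hd h ha
      simp [codeword, this, mul_add]
    rw [letters, List.map_append, List.sum_append, e1, e2, List.sum_map_add, List.sum_map_add,
      ihl hl, ihr hr, ← hw, ← hw, cost]
    ring

theorem HuffmanMerge.letters_eq {α : Type*} {f : α → ℕ} {S : Multiset (CodeTree α)}
    {T : CodeTree α} (h : HuffmanMerge f S T) :
    (T.letters : Multiset α) = (S.map fun z => (z.letters : Multiset α)).sum := by
  induction h with
  | done T => simp
  | merge S x y T hmin h ih =>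
    rw [ih]
    simp [CodeTree.letters, ← Multiset.coe_add, add_assoc]

/-- A Huffman code of a word is at least as good as any code whose lengths satisfy Kraft's
inequality. -/
theorem IsHuffmanCode.sum_length_le {α : Type*} [DecidableEq α] {w : List α}
    {C : α → List Bool} (h : IsHuffmanCode w C) (len : α → ℕ)
    (hK : ∑ a ∈ w.toFinset, (1 / 2 : ℝ) ^ len a ≤ 1) :
    (w.map fun a => (C a).length).sum ≤ (w.map len).sum := by
  rcases h with rfl | ⟨T, hT, hC⟩
  · simp
  have hsum : ∀ g : α → ℕ, (w.map g).sum = ∑ a ∈ w.toFinset, w.count a * g a := by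
    intro g
    rw [Finset.sum_list_map_count]; simp
  have e : (w.map fun a => (C a).length) = w.map fun a => (T.codeword a).length :=
    List.map_congr_left fun a ha => by rw [hC a ha]
  rw [e, hsum, hsum]
  generalize w.toFinset = s at hT hK
  have hlet : (T.letters : Multiset α) = s.val := by
    rw [hT.letters_eq]
    simp only [Multiset.map_map, Function.comp_def, CodeTree.letters, Multiset.coe_singleton,
      Multiset.sum_map_singleton]
  have hnodup : T.letters.Nodup := by
    rw [← Multiset.coe_nodup, hlet]; exact s.nodup
  have hcost := hT.cost_le (s.val.map fun a => (CodeTree.leaf a, len a))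
    (by simp only [Multiset.map_map, Function.comp_def])
    (by rw [Multiset.map_map]; exact hK)
  have e2 : T.cost (fun a => w.count a) = ∑ a ∈ s, w.count a * (T.codeword a).length := by
    rw [← CodeTree.sum_letters_codeword _ _ hnodup, ← Multiset.sum_coe, ← Multiset.map_coe,
      hlet]; rfl
  rw [← e2]
  simp only [Multiset.map_map, Function.comp_def, CodeTree.cost, CodeTree.weight,
    Multiset.map_const', Multiset.sum_replicate, smul_zero, zero_add] at hcost
  exact hcost

/-! ### The Farzan-Munro decomposition -/

/-- The shapes of all completed components of a decomposition. -/
def allShapes : BinaryTree Bool → List (BinaryTree Unit)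
  | .nil => []
  | .node true l r => .node () (localPart l) (localPart r) :: (allShapes l ++ allShapes r)
  | .node false l r => allShapes l ++ allShapes r

/-- `topTier` keeps only the first portal on each side. Only upper bounds are wanted, so a sublist
is enough, and uniqueness of the portal never has to be proved. -/
theorem preorder_shapes_sublist (c : BinaryTree Bool) :
    ((preorder (topTier c)).map Micro.shape).Sublist (allShapes c) := by
  induction c with
  | nil => simp [topTier, preorder, allShapes]
  | node b l r ihl ihr =>
    cases b with
    | true =>
      simp only [topTier, preorder, allShapes, List.map_cons, List.map_append]
      exact (ihl.append ihr).cons_cons _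
    | false =>
      simp only [topTier, allShapes]
      split
      · exact ihr.trans (List.sublist_append_right _ _)
      · rename_i m l' r' h
        rw [h] at ihl
        exact ihl.trans (List.sublist_append_left _ _)

theorem microShapes_sublist (t : BinaryTree Unit) :
    (microShapes t).Sublist (allShapes (cover (blockParam t.numNodes) t)) :=
  preorder_shapes_sublist _

theorem length_preorder {α : Type*} (t : BinaryTree α) : (preorder t).length = t.numNodes := by
  induction t with
  | nil => rfl
  | node a l r ihl ihr => simp [preorder, ihl, ihr]

theorem length_bp {α : Type*} (t : BinaryTree α) : (bp t).length = 2 * t.numNodes := by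
  induction t with
  | nil => rfl
  | node a l r ihl ihr => simp [bp, ihl, ihr]; ring

theorem activeSize_eq (c : BinaryTree Bool) : activeSize c = (localPart c).numNodes := by
  induction c with
  | nil => rfl
  | node b l r ihl ihr => cases b <;> simp [activeSize, localPart, ihl, ihr]

@[simp] theorem activeSize_close (c : BinaryTree Bool) : activeSize (close c) = 0 := by
  cases c <;> rfl

@[simp] theorem localPart_close (c : BinaryTree Bool) : localPart (close c) = .nil := by
  cases c <;> rfl

/-- Closing a component either changes nothing or completes the active component. -/
theorem allShapes_close (c : BinaryTree Bool) :
    allShapes (close c) = allShapes c ∨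
      allShapes (close c) = localPart c :: allShapes c ∧ 0 < activeSize c := by
  rcases c with _ | ⟨_ | _, l, r⟩
  · exact .inl rfl
  · exact .inr ⟨rfl, by simp [activeSize]⟩
  · exact .inl rfl

theorem activeSize_coverRec_lt {B : ℕ} (hB : 1 ≤ B) (t : BinaryTree Unit) :
    activeSize (coverRec B t) < B := by
  cases t with
  | nil => simp [coverRec, activeSize]; omega
  | node a l r =>
    simp only [coverRec]
    split_ifs with h1 h2
    · simp [activeSize]; omega
    · simp; omega
    · exact not_le.1 h2

/-- A light tree is a single active component. -/
theorem coverRec_of_lt {B : ℕ} (t : BinaryTree Unit) (h : t.numNodes < B) :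
    localPart (coverRec B t) = t ∧ allShapes (coverRec B t) = [] := by
  induction t with
  | nil => simp [coverRec, localPart, allShapes]
  | node a l r ihl ihr =>
    simp only [numNodes] at h
    obtain ⟨hl, hl'⟩ := ihl (by omega)
    obtain ⟨hr, hr'⟩ := ihr (by omega)
    have h1 : ¬ (B ≤ l.numNodes ∧ B ≤ r.numNodes) := by omega
    have h2 : ¬ B ≤ activeSize (BinaryTree.node false (coverRec B l) (coverRec B r)) := by
      rw [activeSize, activeSize_eq, activeSize_eq, hl, hr]; omega
    simp only [coverRec, if_neg h1, if_neg h2, localPart, allShapes, hl, hl', hr, hr']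
    simp

/-- The components of a heavy tree, by the cases of the algorithm. -/
theorem coverRec_heavy_cases {B : ℕ} {l r : BinaryTree Unit}
    (h : B ≤ (BinaryTree.node () l r).numNodes) :
    (B ≤ l.numNodes ∧ B ≤ r.numNodes ∧
      coverRec B (.node () l r) = .node true (close (coverRec B l)) (close (coverRec B r))) ∨
    (¬ (B ≤ l.numNodes ∧ B ≤ r.numNodes) ∧
      B ≤ activeSize (.node false (coverRec B l) (coverRec B r)) ∧
      coverRec B (.node () l r) = close (.node false (coverRec B l) (coverRec B r))) ∨
    ((B ≤ l.numNodes ∨ B ≤ r.numNodes) ∧ ¬ (B ≤ l.numNodes ∧ B ≤ r.numNodes) ∧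
      coverRec B (.node () l r) = .node false (coverRec B l) (coverRec B r)) := by
  by_cases h1 : B ≤ l.numNodes ∧ B ≤ r.numNodes
  · exact .inl ⟨h1.1, h1.2, by simp only [coverRec, if_pos h1]⟩
  by_cases h2 : B ≤ activeSize (.node false (coverRec B l) (coverRec B r))
  · exact .inr (.inl ⟨h1, h2, by simp only [coverRec, if_neg h1, if_pos h2]⟩)
  · refine .inr (.inr ⟨?_, h1, by simp only [coverRec, if_neg h1, if_neg h2]⟩)
    by_contra h3
    push Not at h3
    rw [activeSize, activeSize_eq, activeSize_eq, (coverRec_of_lt l h3.1).1,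
      (coverRec_of_lt r h3.2).1] at h2
    simp only [numNodes] at h
    omega

theorem numNodes_le_of_mem_allShapes_close {B : ℕ} {c : BinaryTree Bool}
    (hc : activeSize c < 2 * B) (h : ∀ s ∈ allShapes c, s.numNodes < 2 * B) :
    ∀ s ∈ allShapes (close c), s.numNodes < 2 * B := by
  intro s hs
  rcases allShapes_close c with h' | ⟨h', -⟩ <;> rw [h'] at hs
  · exact h s hs
  · rcases List.mem_cons.1 hs with rfl | hs
    · rwa [← activeSize_eq]
    · exact h s hs

/-- A component is a node together with at most two active components, each with at most `B - 1`
nodes. -/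
theorem numNodes_le_of_mem_allShapes_coverRec {B : ℕ} (hB : 1 ≤ B) (t : BinaryTree Unit) :
    ∀ s ∈ allShapes (coverRec B t), s.numNodes < 2 * B := by
  induction t with
  | nil => simp [coverRec, allShapes]
  | node a l r ihl ihr =>
    have hl := activeSize_coverRec_lt hB l
    have hr := activeSize_coverRec_lt hB r
    simp only [coverRec]
    have hf : ∀ s ∈ allShapes (.node false (coverRec B l) (coverRec B r)),
        s.numNodes < 2 * B := by
      intro s hs
      rcases List.mem_append.1 hs with hs | hs
      exacts [ihl s hs, ihr s hs]
    split_ifs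
    · intro s hs
      simp only [allShapes, localPart_close, List.mem_cons, List.mem_append] at hs
      rcases hs with rfl | hs | hs
      · simp; omega
      · exact numNodes_le_of_mem_allShapes_close (by omega) ihl s hs
      · exact numNodes_le_of_mem_allShapes_close (by omega) ihr s hs
    · exact numNodes_le_of_mem_allShapes_close (by rw [activeSize]; omega) hf
    · exact hf

/-- Micro trees are small. -/
theorem numNodes_lt_of_mem_microShapes {t s : BinaryTree Unit} (hs : s ∈ microShapes t) :
    s.numNodes < 2 * blockParam t.numNodes := by
  have hB : 1 ≤ blockParam t.numNodes := le_max_left _ _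
  refine numNodes_le_of_mem_allShapes_close ?_ (numNodes_le_of_mem_allShapes_coverRec hB t) s
    ((microShapes_sublist t).subset hs)
  have := activeSize_coverRec_lt hB t
  omega

theorem length_allShapes_close_le (c : BinaryTree Bool) :
    (allShapes (close c)).length ≤ (allShapes c).length + 1 := by
  rcases allShapes_close c with h | ⟨h, -⟩ <;> simp [h]

/-- There are few components. -/
theorem length_allShapes_coverRec {B : ℕ} (hB : 1 ≤ B) (t : BinaryTree Unit)
    (ht : B ≤ t.numNodes) :
    B * (allShapes (coverRec B t)).length + 4 * activeSize (coverRec B t) + 3 * B ≤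
      4 * t.numNodes := by
  -- Amortised count: each node brings 4 credits, each permanent component costs `B`, active nodes
  -- keep their credits, and a heavy tree holds a reserve of `3 * B`. With two heavy children, one
  -- of the two reserves pays for the up to three new components. Otherwise a closed component has
  -- at least `B` nodes, whose `4 * B` credits pay for it and, if no child is heavy, also create the
  -- reserve.
  induction t with
  | nil => simp at ht; omega
  | node a l r ihl ihr =>
    have light : ∀ u : BinaryTree Unit, u.numNodes < B →
        (allShapes (coverRec B u)).length = 0 ∧ activeSize (coverRec B u) = u.numNodes := by
      intro u hu
      rw [activeSize_eq, (coverRec_of_lt u hu).1, (coverRec_of_lt u hu).2]; simp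
    have cl := length_allShapes_close_le (coverRec B l)
    have cr := length_allShapes_close_le (coverRec B r)
    have key : ¬ (B ≤ l.numNodes ∧ B ≤ r.numNodes) →
        B * ((allShapes (coverRec B l)).length + (allShapes (coverRec B r)).length) +
          4 * (activeSize (coverRec B l) + activeSize (coverRec B r)) +
          (if B ≤ l.numNodes ∨ B ≤ r.numNodes then 3 * B else 0) ≤
          4 * (l.numNodes + r.numNodes) := by
      intro h
      by_cases hl : B ≤ l.numNodes
      · have hr : r.numNodes < B := by omega
        rw [(light r hr).1, (light r hr).2, if_pos (.inl hl)]
        have := ihl hl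
        simp only [add_zero]; omega
      · by_cases hr : B ≤ r.numNodes
        · rw [(light l (by omega)).1, (light l (by omega)).2, if_pos (.inr hr)]
          have := ihr hr
          simp only [zero_add]; omega
        · rw [(light l (by omega)).1, (light l (by omega)).2, (light r (by omega)).1,
            (light r (by omega)).2, if_neg (by omega)]
          simp
    rcases coverRec_heavy_cases ht with ⟨hl, hr, h⟩ | ⟨h1, h2, h⟩ | ⟨h1, h2, h⟩
    · rw [h]
      have := ihl hl
      have := ihr hr
      simp only [allShapes, activeSize, List.length_cons, List.length_append, numNodes]
      nlinarith [Nat.mul_le_mul_left B cl, Nat.mul_le_mul_left B cr]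
    · rw [h]
      simp only [close, allShapes, activeSize, List.length_cons, List.length_append, numNodes]
        at h2 ht ⊢
      have := key h1
      split_ifs at this with h3
      · nlinarith
      · have h4 : l.numNodes < B := by omega
        have h5 : r.numNodes < B := by omega
        rw [(light l h4).1, (light r h5).1]
        omega
    · rw [h]
      have := key h2
      rw [if_pos h1] at this
      simp only [allShapes, activeSize, List.length_append, numNodes]
      omega

theorem length_microShapes_mul_le (t : BinaryTree Unit)
    (ht : blockParam t.numNodes ≤ t.numNodes) :
    blockParam t.numNodes * (microShapes t).length ≤ 4 * t.numNodes := by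
  have hB : 1 ≤ blockParam t.numNodes := le_max_left _ _
  have h1 := (microShapes_sublist t).length_le
  have h2 := length_allShapes_close_le (coverRec (blockParam t.numNodes) t)
  have h3 := length_allShapes_coverRec hB t ht
  rw [cover] at h1
  have := Nat.mul_le_mul_left (blockParam t.numNodes) (h1.trans h2)
  nlinarith

/-! ### Weights of micro trees -/

/-- The tree `t` is empty or has property `P`. -/
def InClass (P : BinaryTree Unit → Prop) (t : BinaryTree Unit) : Prop :=
  t ∈ subclass P t.numNodes

theorem inClass_iff {P : BinaryTree Unit → Prop} {t : BinaryTree Unit} :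
    InClass P t ↔ t = .nil ∨ P t := by
  simp [InClass, subclass]

theorem mem_subclass {P : BinaryTree Unit → Prop} {n : ℕ} {t : BinaryTree Unit} :
    t ∈ subclass P n ↔ t.numNodes = n ∧ InClass P t := by
  simp [inClass_iff, subclass]

theorem self_mem_fringeSubtrees {α : Type*} {t : BinaryTree α} (h : t ≠ .nil) :
    t ∈ fringeSubtrees t := by
  cases t
  · exact absurd rfl h
  · simp [fringeSubtrees]

theorem FringeHereditary.children {P : BinaryTree Unit → Prop} (hP : FringeHereditary P)
    {l r : BinaryTree Unit} (h : InClass P (.node () l r)) : InClass P l ∧ InClass P r := by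
  have key : ∀ s ∈ fringeSubtrees (BinaryTree.node () l r), InClass P s := hP _ _ h
  constructor
  · rcases eq_or_ne l .nil with rfl | hl
    · exact inClass_iff.2 (.inl rfl)
    · exact key _ (by simp [fringeSubtrees, self_mem_fringeSubtrees hl])
  · rcases eq_or_ne r .nil with rfl | hr
    · exact inClass_iff.2 (.inl rfl)
    · exact key _ (by simp [fringeSubtrees, self_mem_fringeSubtrees hr])

/-- A subprobability weight that is uniform on the trees of `P` of a given size. -/
noncomputable def fringeWeight (P : BinaryTree Unit → Prop) (u : BinaryTree Unit) : ℝ :=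
  open Classical in
  if InClass P u then
    (((u.numNodes : ℝ) + 1) * (u.numNodes + 2) * (subclass P u.numNodes).card)⁻¹
  else 0

/-- The weight of a tree that consists of a path ending in a null pointer, with subtrees from `P`
attached to it. -/
noncomputable def pathWeight (P : BinaryTree Unit → Prop) : BinaryTree Unit → ℝ
  | .nil => 1 / 4
  | .node _ l r => 1 / 4 * (pathWeight P l * fringeWeight P r + fringeWeight P l * pathWeight P r)

/-- The weight of the shape of a micro tree. -/
noncomputable def shapeWeight (P : BinaryTree Unit → Prop) (u : BinaryTree Unit) : ℝ :=
  (fringeWeight P u + pathWeight P u) / 2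

theorem card_subclass_pos {P : BinaryTree Unit → Prop} {u : BinaryTree Unit} (h : InClass P u) :
    0 < (subclass P u.numNodes).card := Finset.card_pos.2 ⟨u, h⟩

theorem fringeWeight_pos {P : BinaryTree Unit → Prop} {u : BinaryTree Unit} (h : InClass P u) :
    0 < fringeWeight P u := by
  have := card_subclass_pos h
  rw [fringeWeight, if_pos h]
  positivity

theorem fringeWeight_nonneg (P : BinaryTree Unit → Prop) (u : BinaryTree Unit) :
    0 ≤ fringeWeight P u := by
  unfold fringeWeight; split_ifs <;> positivity

theorem pathWeight_nonneg (P : BinaryTree Unit → Prop) (u : BinaryTree Unit) :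
    0 ≤ pathWeight P u := by
  induction u with
  | nil => norm_num [pathWeight]
  | node a l r ihl ihr =>
    have := fringeWeight_nonneg P l
    have := fringeWeight_nonneg P r
    rw [pathWeight]; positivity

theorem sum_fringeWeight_treesOfNumNodesEq_le (P : BinaryTree Unit → Prop) (k : ℕ) :
    ∑ u ∈ treesOfNumNodesEq k, fringeWeight P u ≤ (((k : ℝ) + 1) * (k + 2))⁻¹ := by
  classical
  have h : ∑ u ∈ treesOfNumNodesEq k, fringeWeight P u =
      ∑ u ∈ subclass P k, (((k : ℝ) + 1) * (k + 2) * (subclass P k).card)⁻¹ := by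
    rw [← Finset.sum_subset (s₁ := subclass P k)]
    · refine Finset.sum_congr rfl fun u hu => ?_
      obtain ⟨rfl, hu'⟩ := mem_subclass.1 hu
      rw [fringeWeight, if_pos hu']
    · intro u hu
      rw [mem_treesOfNumNodesEq]
      exact (mem_subclass.1 hu).1
    · intro u hu hu'
      rw [mem_treesOfNumNodesEq] at hu
      rw [fringeWeight, if_neg]
      exact fun h => hu' (mem_subclass.2 ⟨hu, h⟩)
  rw [h, Finset.sum_const, nsmul_eq_mul, mul_inv]
  rcases Nat.eq_zero_or_pos (subclass P k).card with h0 | h0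
  · rw [h0]; simp; positivity
  · rw [mul_comm _ ((subclass P k).card : ℝ)⁻¹, ← mul_assoc, mul_inv_cancel₀ (by positivity),
      one_mul]

/-- The trees with fewer than `N` nodes. -/
def treesOfNumNodesLT (N : ℕ) : Finset (BinaryTree Unit) :=
  (Finset.range N).biUnion treesOfNumNodesEq

theorem mem_treesOfNumNodesLT {N : ℕ} {u : BinaryTree Unit} :
    u ∈ treesOfNumNodesLT N ↔ u.numNodes < N := by
  simp [treesOfNumNodesLT]

theorem sum_treesOfNumNodesLT {β : Type*} [AddCommMonoid β] (N : ℕ) (g : BinaryTree Unit → β) :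
    ∑ u ∈ treesOfNumNodesLT N, g u = ∑ k ∈ Finset.range N, ∑ u ∈ treesOfNumNodesEq k, g u := by
  rw [treesOfNumNodesLT, Finset.sum_biUnion]
  intro i _ j _ hij
  simp only [Function.onFun, Finset.disjoint_left, mem_treesOfNumNodesEq]
  intro u h1 h2
  exact hij (h1.symm.trans h2)

/-- The factors `1 / ((k + 1) (k + 2))` over the sizes telescope. -/
theorem sum_fringeWeight_le_one (P : BinaryTree Unit → Prop) (N : ℕ) :
    ∑ u ∈ treesOfNumNodesLT N, fringeWeight P u ≤ 1 := by
  rw [sum_treesOfNumNodesLT]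
  have h : ∀ N : ℕ, ∑ k ∈ Finset.range N, (((k : ℝ) + 1) * (k + 2))⁻¹ = 1 - ((N : ℝ) + 1)⁻¹ := by
    intro N
    induction N with
    | zero => simp
    | succ N ih =>
      rw [Finset.sum_range_succ, ih]
      push_cast
      field_simp
      ring
  refine (Finset.sum_le_sum fun k _ => sum_fringeWeight_treesOfNumNodesEq_le P k).trans ?_
  rw [h]
  have : 0 ≤ ((N : ℝ) + 1)⁻¹ := by positivity
  linarith

/-- With `F ≤ 1` the sum of the fringe weights, the bound `S` on the path weights passes to `1/4 +
(1/4)(2 S F)`, and `1/2` is a fixed point for `F = 1`. -/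
theorem sum_pathWeight_le (P : BinaryTree Unit → Prop) (N : ℕ) :
    ∑ u ∈ treesOfNumNodesLT N, pathWeight P u ≤ 1 / 2 := by
  classical
  induction N with
  | zero => simp [treesOfNumNodesLT]
  | succ N ih =>
    set U := treesOfNumNodesLT N with hU
    have hsub : treesOfNumNodesLT (N + 1) ⊆ insert .nil (pairwiseNode U U) := by
      intro u hu
      rw [mem_treesOfNumNodesLT] at hu
      cases u with
      | nil => simp
      | node a l r =>
        simp only [numNodes] at hu
        simp only [Finset.mem_insert, Finset.mem_map, Finset.mem_product]
        refine .inr ⟨(l, r), ⟨?_, ?_⟩, rfl⟩ <;> rw [hU, mem_treesOfNumNodesLT] <;> dsimp only <;>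
          omega
    refine (Finset.sum_le_sum_of_subset_of_nonneg hsub
      fun u _ _ => pathWeight_nonneg P u).trans ?_
    rw [Finset.sum_insert (by simp), Finset.sum_map, Finset.sum_product]
    have hprod : ∑ l ∈ U, ∑ r ∈ U, pathWeight P (.node () l r) =
        1 / 4 * ((∑ u ∈ U, pathWeight P u) * (∑ u ∈ U, fringeWeight P u) +
          (∑ u ∈ U, fringeWeight P u) * ∑ u ∈ U, pathWeight P u) := by
      rw [Finset.sum_mul_sum, Finset.sum_mul_sum]
      simp only [pathWeight, ← Finset.sum_add_distrib, Finset.mul_sum]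
    change pathWeight P .nil + ∑ l ∈ U, ∑ r ∈ U, pathWeight P (.node () l r) ≤ _
    rw [hprod, pathWeight]
    have h1 := sum_fringeWeight_le_one P N
    rw [← hU] at h1
    have h2 : 0 ≤ ∑ u ∈ U, pathWeight P u := Finset.sum_nonneg fun u _ => pathWeight_nonneg P u
    have h3 : 0 ≤ ∑ u ∈ U, fringeWeight P u :=
      Finset.sum_nonneg fun u _ => fringeWeight_nonneg P u
    nlinarith

theorem pathWeight_le (P : BinaryTree Unit → Prop) (u : BinaryTree Unit) :
    pathWeight P u ≤ 1 / 2 :=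
  (Finset.single_le_sum (fun v _ => pathWeight_nonneg P v)
    (mem_treesOfNumNodesLT.2 (Nat.lt_succ_self _))).trans (sum_pathWeight_le P _)

theorem sum_shapeWeight_le_one (P : BinaryTree Unit → Prop) (F : Finset (BinaryTree Unit)) :
    ∑ u ∈ F, shapeWeight P u ≤ 1 := by
  have hsub : F ⊆ treesOfNumNodesLT (F.sup numNodes + 1) := fun u hu =>
    mem_treesOfNumNodesLT.2 (Nat.lt_succ_of_le (Finset.le_sup (f := numNodes) hu))
  have hnn : ∀ u, 0 ≤ shapeWeight P u := fun u => by
    have := fringeWeight_nonneg P u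
    have := pathWeight_nonneg P u
    unfold shapeWeight; positivity
  refine (Finset.sum_le_sum_of_subset_of_nonneg hsub fun u _ _ => hnn u).trans ?_
  simp only [shapeWeight, ← Finset.sum_div, Finset.sum_add_distrib]
  have := sum_fringeWeight_le_one P (F.sup numNodes + 1)
  have := sum_pathWeight_le P (F.sup numNodes + 1)
  linarith

/-! ### Code lengths from weights -/

/-- The length of a codeword for an event of probability `x`. -/
noncomputable def cost (x : ℝ) : ℝ := -Real.logb 2 x

theorem cost_le_cost {x y : ℝ} (hx : 0 < x) (h : x ≤ y) : cost y ≤ cost x :=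
  neg_le_neg (Real.logb_le_logb_of_le (by norm_num) hx h)

theorem cost_mul {x y : ℝ} (hx : 0 < x) (hy : 0 < y) : cost (x * y) = cost x + cost y := by
  rw [cost, Real.logb_mul hx.ne' hy.ne', neg_add]; rfl

theorem cost_nonneg {x : ℝ} (h0 : 0 ≤ x) (h : x ≤ 1) : 0 ≤ cost x :=
  neg_nonneg.2 (Real.logb_nonpos (by norm_num) h0 h)

theorem cost_half_pow (k : ℕ) : cost ((1 / 2) ^ k) = k := by
  rw [cost, Real.logb_pow, one_div, Real.logb_inv, Real.logb_self_eq_one (by norm_num)]; simp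

/-- Lengths of codewords for the shapes of micro trees. -/
noncomputable def shapeLength (P : BinaryTree Unit → Prop) (u : BinaryTree Unit) : ℕ :=
  ⌈cost (shapeWeight P u)⌉₊

/-- Positivity is essential: `Real.logb 2 0 = 0` would give a shape of weight zero the length zero.
-/
theorem kraft_shapeLength (P : BinaryTree Unit → Prop) (F : Finset (BinaryTree Unit))
    (hF : ∀ u ∈ F, 0 < shapeWeight P u) : ∑ u ∈ F, (1 / 2 : ℝ) ^ shapeLength P u ≤ 1 := by
  refine (Finset.sum_le_sum fun u hu => ?_).trans (sum_shapeWeight_le_one P F)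
  by_contra h
  push Not at h
  have h1 : cost (shapeWeight P u) ≤ shapeLength P u := Nat.le_ceil _
  have h2 : cost ((1 / 2) ^ shapeLength P u) < cost (shapeWeight P u) :=
    neg_lt_neg (Real.logb_lt_logb (by norm_num) (hF u hu) h)
  rw [cost_half_pow] at h2
  linarith

/-- Averaging the two weights costs one bit, here and in `shapeWeight_of_path`. -/
theorem shapeWeight_of_inClass {P : BinaryTree Unit → Prop} {u : BinaryTree Unit}
    (h : 0 < fringeWeight P u) :
    0 < shapeWeight P u ∧ cost (shapeWeight P u) ≤ cost (fringeWeight P u) + 1 := by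
  have h1 := pathWeight_nonneg P u
  have hle : fringeWeight P u * (1 / 2) ^ 1 ≤ shapeWeight P u := by unfold shapeWeight; linarith
  refine ⟨lt_of_lt_of_le (by positivity) hle, (cost_le_cost (by positivity) hle).trans ?_⟩
  rw [cost_mul h (by positivity), cost_half_pow]; simp

theorem shapeWeight_of_path {P : BinaryTree Unit → Prop} {u : BinaryTree Unit}
    (h : 0 < pathWeight P u) :
    0 < shapeWeight P u ∧ cost (shapeWeight P u) ≤ cost (pathWeight P u) + 1 := by
  have h1 := fringeWeight_nonneg P u
  have hle : pathWeight P u * (1 / 2) ^ 1 ≤ shapeWeight P u := by unfold shapeWeight; linarith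
  refine ⟨lt_of_lt_of_le (by positivity) hle, (cost_le_cost (by positivity) hle).trans ?_⟩
  rw [cost_mul h (by positivity), cost_half_pow]; simp

theorem cost_pathWeight_nil (P : BinaryTree Unit → Prop) : cost (pathWeight P .nil) = 2 := by
  rw [pathWeight, show (1 / 4 : ℝ) = (1 / 2) ^ 2 by norm_num, cost_half_pow]; simp

theorem pathWeight_node_left {P : BinaryTree Unit → Prop} {l r : BinaryTree Unit}
    (hl : 0 < pathWeight P l) (hr : 0 < fringeWeight P r) :
    0 < pathWeight P (.node () l r) ∧
      cost (pathWeight P (.node () l r)) ≤ 2 + cost (pathWeight P l) + cost (fringeWeight P r) := by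
  have h1 := mul_nonneg (fringeWeight_nonneg P l) (pathWeight_nonneg P r)
  have hle : (1 / 2) ^ 2 * pathWeight P l * fringeWeight P r ≤ pathWeight P (.node () l r) := by
    rw [pathWeight]; linarith
  refine ⟨lt_of_lt_of_le (by positivity) hle, (cost_le_cost (by positivity) hle).trans ?_⟩
  rw [cost_mul (by positivity) hr, cost_mul (by positivity) hl, cost_half_pow]; simp

theorem pathWeight_node_right {P : BinaryTree Unit → Prop} {l r : BinaryTree Unit}
    (hl : 0 < fringeWeight P l) (hr : 0 < pathWeight P r) :
    0 < pathWeight P (.node () l r) ∧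
      cost (pathWeight P (.node () l r)) ≤ 2 + cost (pathWeight P r) + cost (fringeWeight P l) := by
  have h1 := mul_nonneg (pathWeight_nonneg P l) (fringeWeight_nonneg P r)
  have hle : (1 / 2) ^ 2 * pathWeight P r * fringeWeight P l ≤ pathWeight P (.node () l r) := by
    rw [pathWeight]; linarith
  refine ⟨lt_of_lt_of_le (by positivity) hle, (cost_le_cost (by positivity) hle).trans ?_⟩
  rw [cost_mul (by positivity) hl, cost_mul (by positivity) hr, cost_half_pow]; simp

/-- For the components `{v}` between two heavy children. Counted as a path, such a node costs 2 for
the end of the path, 2 for the node, 1 for the empty fringe subtree and 1 for the averaging. -/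
theorem shapeWeight_leaf (P : BinaryTree Unit → Prop) :
    0 < shapeWeight P (.node () .nil .nil) ∧ cost (shapeWeight P (.node () .nil .nil)) ≤ 6 := by
  have hnil : InClass P .nil := inClass_iff.2 (.inl rfl)
  have hs : subclass P (numNodes (.nil : BinaryTree Unit)) = {.nil} := by
    ext t; rw [mem_subclass]
    cases t <;> simp [hnil]
  have hf : fringeWeight P .nil = (1 / 2) ^ 1 := by
    rw [fringeWeight, if_pos hnil, hs]; norm_num
  have hp : 0 < pathWeight P .nil := by norm_num [pathWeight]
  obtain ⟨h1, h2⟩ := pathWeight_node_left hp (fringeWeight_pos hnil)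
  obtain ⟨h3, h4⟩ := shapeWeight_of_path h1
  refine ⟨h3, ?_⟩
  rw [cost_pathWeight_nil, hf, cost_half_pow] at h2
  push_cast at h2
  linarith

/-! ### The cost of the decomposition -/

/-- The total cost of the completed components. -/
noncomputable def totalCost (P : BinaryTree Unit → Prop) (c : BinaryTree Bool) : ℝ :=
  ((allShapes c).map fun s => cost (shapeWeight P s)).sum

/-- Closing turns the path cost of the active component into a shape cost, one bit more. If nothing
is active, the bound survives since path costs are nonnegative. -/
theorem totalCost_close {P : BinaryTree Unit → Prop} {c : BinaryTree Bool}
    (h : ∀ s ∈ allShapes c, 0 < shapeWeight P s) (hp : 0 < pathWeight P (localPart c)) :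
    (∀ s ∈ allShapes (close c), 0 < shapeWeight P s) ∧
      totalCost P (close c) ≤ totalCost P c + cost (pathWeight P (localPart c)) + 1 := by
  have h0 : 0 ≤ cost (pathWeight P (localPart c)) :=
    cost_nonneg hp.le ((pathWeight_le P _).trans (by norm_num))
  obtain ⟨h1, h2⟩ := shapeWeight_of_path hp
  unfold totalCost
  rcases allShapes_close c with h' | ⟨h', -⟩ <;> rw [h']
  · exact ⟨h, by linarith⟩
  · refine ⟨by simpa using ⟨h1, h⟩, ?_⟩
    rw [List.map_cons, List.sum_cons]; linarith

/-- The cost of the components of a heavy tree, provided that heavy trees have large subtrees. -/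
theorem totalCost_coverRec_le {P : BinaryTree Unit → Prop} (hP : FringeHereditary P)
    {c K : ℝ} {B k₀ : ℕ} (hc : 0 ≤ c) (hK : 12 ≤ K)
    (hF : ∀ u, InClass P u → cost (fringeWeight P u) + 3 ≤ c * u.numNodes + K)
    (hF' : ∀ u, InClass P u → k₀ ≤ u.numNodes → cost (fringeWeight P u) + 2 ≤ c * u.numNodes)
    (hT : ∀ l r, InClass P (.node () l r) → B ≤ (BinaryTree.node () l r).numNodes →
      k₀ ≤ l.numNodes ∧ k₀ ≤ r.numNodes)
    (hB : 1 ≤ B) (t : BinaryTree Unit) (ht : InClass P t) (hBt : B ≤ t.numNodes) :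
    (∀ s ∈ allShapes (coverRec B t), 0 < shapeWeight P s) ∧
      0 < pathWeight P (localPart (coverRec B t)) ∧
      totalCost P (coverRec B t) + cost (pathWeight P (localPart (coverRec B t))) ≤
        c * t.numNodes + K * (allShapes (coverRec B t)).length + 2 := by
  induction t with
  | nil => simp at hBt; omega
  | node a l r ihl ihr =>
    obtain ⟨hl, hr⟩ := hP.children ht
    obtain ⟨hkl, hkr⟩ := hT l r ht hBt
    have hcl : (0 : ℝ) ≤ c * l.numNodes := by positivity
    have hcr : (0 : ℝ) ≤ c * r.numNodes := by positivity
    have hnn : ((BinaryTree.node () l r).numNodes : ℝ) = l.numNodes + r.numNodes + 1 := by simp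
    have hnil : 0 < pathWeight P .nil := by norm_num [pathWeight]
    -- The path grows by one node: the heavy child continues it and the light child hangs off it as
    -- a whole fringe subtree. By `hT` the light child has at least `k₀` nodes, so `hF'` pays for it
    -- and for the two bits of the node, and no constant accumulates along the path.
    have key : (B ≤ l.numNodes ∨ B ≤ r.numNodes) → ¬ (B ≤ l.numNodes ∧ B ≤ r.numNodes) →
        (∀ s ∈ allShapes (.node false (coverRec B l) (coverRec B r)), 0 < shapeWeight P s) ∧
        0 < pathWeight P (localPart (.node false (coverRec B l) (coverRec B r))) ∧
        totalCost P (.node false (coverRec B l) (coverRec B r)) +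
          cost (pathWeight P (localPart (.node false (coverRec B l) (coverRec B r)))) ≤
        c * (l.numNodes + r.numNodes + 1) +
          K * (allShapes (.node false (coverRec B l) (coverRec B r))).length + 2 := by
      intro h1 h2
      by_cases hBl : B ≤ l.numNodes
      · obtain ⟨e1, e2⟩ := coverRec_of_lt (B := B) r (by omega)
        obtain ⟨i1, i2, i3⟩ := ihl hl hBl
        obtain ⟨j1, j2⟩ := pathWeight_node_left i2 (fringeWeight_pos hr)
        have := hF' r hr hkr
        simp only [totalCost, allShapes, localPart, e1, e2, List.append_nil] at i3 ⊢
        exact ⟨i1, j1, by linarith⟩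
      · have hBr : B ≤ r.numNodes := by omega
        obtain ⟨e1, e2⟩ := coverRec_of_lt (B := B) l (by omega)
        obtain ⟨i1, i2, i3⟩ := ihr hr hBr
        obtain ⟨j1, j2⟩ := pathWeight_node_right (fringeWeight_pos hl) i2
        have := hF' l hl hkl
        simp only [totalCost, allShapes, localPart, e1, e2, List.nil_append] at i3 ⊢
        exact ⟨i1, j1, by linarith⟩
    rcases coverRec_heavy_cases hBt with ⟨hBl, hBr, h⟩ | ⟨h1, h2, h⟩ | ⟨h1, h2, h⟩ <;>
      rw [h, hnn]
    -- The allowance `K ≥ 12` of the new singleton is used up here: 6 for its shape, and for each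
    -- child the additive 2 and the bit for closing.
    · obtain ⟨l1, l2, l3⟩ := ihl hl hBl
      obtain ⟨r1, r2, r3⟩ := ihr hr hBr
      obtain ⟨l4, l5⟩ := totalCost_close l1 l2
      obtain ⟨r4, r5⟩ := totalCost_close r1 r2
      obtain ⟨s1, s2⟩ := shapeWeight_leaf P
      have ll : (allShapes (coverRec B l)).length ≤ (allShapes (close (coverRec B l))).length := by
        rcases allShapes_close (coverRec B l) with h | ⟨h, -⟩ <;> simp [h]
      have lr : (allShapes (coverRec B r)).length ≤ (allShapes (close (coverRec B r))).length := by
        rcases allShapes_close (coverRec B r) with h | ⟨h, -⟩ <;> simp [h]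
      have ll' : (((allShapes (coverRec B l)).length : ℕ) : ℝ) ≤
        ((allShapes (close (coverRec B l))).length : ℕ) := by exact_mod_cast ll
      have lr' : (((allShapes (coverRec B r)).length : ℕ) : ℝ) ≤
        ((allShapes (close (coverRec B r))).length : ℕ) := by exact_mod_cast lr
      simp only [totalCost, allShapes, localPart, localPart_close, List.map_cons, List.map_append,
        List.sum_cons, List.sum_append, List.length_cons, List.length_append,
        cost_pathWeight_nil] at l5 r5 l3 r3 ⊢
      refine ⟨?_, hnil, ?_⟩
      · intro s hs
        simp only [List.mem_cons, List.mem_append] at hs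
        rcases hs with rfl | hs | hs
        exacts [s1, l4 s hs, r4 s hs]
      · push_cast
        nlinarith
    · by_cases h3 : B ≤ l.numNodes ∨ B ≤ r.numNodes
      · obtain ⟨k1, k2, k3⟩ := key h3 h1
        obtain ⟨k4, k5⟩ := totalCost_close k1 k2
        rw [localPart_close, cost_pathWeight_nil]
        refine ⟨k4, hnil, ?_⟩
        simp only [close, allShapes, List.length_cons] at k3 k5 ⊢
        push_cast
        nlinarith
      · push Not at h3
        obtain ⟨e1, e2⟩ := coverRec_of_lt l h3.1
        obtain ⟨e3, e4⟩ := coverRec_of_lt r h3.2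
        obtain ⟨s1, s2⟩ := shapeWeight_of_inClass (fringeWeight_pos ht)
        have := hF _ ht
        rw [hnn] at this
        simp only [totalCost, close, allShapes, localPart, e1, e2, e3, e4, cost_pathWeight_nil,
          List.append_nil, List.map_cons, List.map_nil, List.sum_cons, List.sum_nil,
          List.length_cons, List.length_nil]
        refine ⟨by simpa using s1, hnil, ?_⟩
        push_cast
        linarith
    · exact key h1 h2

/-! ### The length of the hypersuccinct code -/

theorem length_eliasGamma_le (k : ℕ) : (eliasGamma k).length ≤ 2 * Nat.log 2 k + 1 := by
  have h : k.bits.length ≤ Nat.log 2 k + 1 := by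
    rw [Nat.size_eq_bits_len, Nat.size_le]
    exact Nat.lt_pow_succ_log_self (by norm_num) k
  simp only [eliasGamma, List.length_append, List.length_replicate, List.length_reverse]
  omega

theorem length_eliasGamma_succ_le (k : ℕ) : (eliasGamma (k + 1)).length ≤ 2 * k + 1 := by
  have := length_eliasGamma_le (k + 1)
  have : Nat.log 2 (k + 1) < k + 1 := Nat.log_lt_self 2 (Nat.succ_ne_zero k)
  omega

theorem length_eliasGamma_le_self (k : ℕ) : (eliasGamma k).length ≤ 2 * k + 1 := by
  have := length_eliasGamma_le k
  have := Nat.log_le_self 2 k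
  omega

/-- The escape code is used only when `C` is longer than it up to the flag and one more bit, so at
most one bit is lost against `C`. The bound linear in the size of the tree controls the codebook. -/
theorem length_lengthRestrict_le (C : BinaryTree Unit → List Bool) (t : BinaryTree Unit) :
    (lengthRestrict C t).length ≤ (C t).length + 1 ∧
      (lengthRestrict C t).length ≤ 4 * t.numNodes + 2 := by
  have h1 := length_eliasGamma_le (t.numNodes + 1)
  have h2 : Nat.log 2 (t.numNodes + 1) < t.numNodes + 1 := Nat.log_lt_self 2 (Nat.succ_ne_zero _)
  unfold lengthRestrict
  split_ifs <;> simp only [List.length_cons, List.length_append, length_bp] <;> omega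

theorem catalan_le_four_pow (n : ℕ) : catalan n ≤ 4 ^ n := by
  rw [catalan_eq_centralBinom_div]
  exact (Nat.div_le_self _ _).trans (Nat.centralBinom_le_four_pow n)

theorem card_treesOfNumNodesLT_le (N : ℕ) : (treesOfNumNodesLT N).card ≤ 4 ^ N := by
  have h : (treesOfNumNodesLT N).card ≤ ∑ k ∈ Finset.range N, 4 ^ k :=
    Finset.card_biUnion_le.trans (Finset.sum_le_sum fun k _ => by
      rw [treesOfNumNodesEq_card_eq_catalan]; exact catalan_le_four_pow k)
  refine h.trans ?_
  clear h
  induction N with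
  | zero => simp
  | succ N ih => rw [Finset.sum_range_succ, pow_succ]; omega

theorem length_dedup_le {w : List (BinaryTree Unit)} {N : ℕ} (h : ∀ s ∈ w, s.numNodes < N) :
    w.dedup.length ≤ 4 ^ N := by
  rw [← List.card_toFinset]
  exact (Finset.card_le_card fun s hs =>
    mem_treesOfNumNodesLT.2 (h s (by simpa using hs))).trans (card_treesOfNumNodesLT_le N)

theorem sum_map_le_length_mul {α : Type*} {w : List α} {g : α → ℕ} {b : ℕ}
    (h : ∀ a ∈ w, g a ≤ b) : (w.map g).sum ≤ w.length * b := by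
  have := List.sum_le_card_nsmul (w.map g) b (by simpa using h)
  simpa using this

/-- At most `4 ^ (2 * B)` shapes occur, with at most `32 * B` bits each; `34` also absorbs the code
for their number, and `16 ^ B * 2 ^ B = 32 ^ B`. -/
theorem length_codebook_le {w : List (BinaryTree Unit)} {B : ℕ} (hB : 1 ≤ B)
    (h : ∀ s ∈ w, s.numNodes < 2 * B) (C : BinaryTree Unit → List Bool) :
    (codebook w.dedup (lengthRestrict C)).length ≤ 34 * 32 ^ B + 1 := by
  have h1 := length_dedup_le h
  have h2 := length_eliasGamma_succ_le w.dedup.length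
  have h3 : ∀ s ∈ w.dedup, (eliasGamma (lengthRestrict C s).length ++ lengthRestrict C s ++
      eliasGamma s.numNodes ++ bp s).length ≤ 32 * B := by
    intro s hs
    have := h s (by simpa using hs)
    have := (length_lengthRestrict_le C s).2
    have := length_eliasGamma_le_self (lengthRestrict C s).length
    have := length_eliasGamma_le_self s.numNodes
    simp only [List.length_append, length_bp]
    omega
  have h4 := sum_map_le_length_mul h3
  rw [codebook, List.length_append, List.length_flatMap]
  have h5 : (32 : ℕ) ^ B = 4 ^ (2 * B) * 2 ^ B := by rw [pow_mul, ← mul_pow]; norm_num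
  have h6 : B ≤ 2 ^ B := Nat.lt_two_pow_self.le
  have h7 : w.dedup.length * (34 * B) ≤ 34 * 32 ^ B := by
    rw [h5]
    calc w.dedup.length * (34 * B) ≤ 4 ^ (2 * B) * (34 * 2 ^ B) :=
          Nat.mul_le_mul h1 (Nat.mul_le_mul_left _ h6)
      _ = _ := by ring
  have h8 : w.dedup.length ≤ w.dedup.length * B := Nat.le_mul_of_pos_right _ hB
  have h9 : w.dedup.length * (34 * B) = w.dedup.length * (32 * B) + 2 * (w.dedup.length * B) := by
    ring
  omega

theorem numNodes_tiers (t : BinaryTree Unit) : (tiers t).numNodes = (microShapes t).length := by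
  rw [microShapes, List.length_map, length_preorder]

theorem length_portalBits (w : ℕ) (m : Micro) : (portalBits w m).length = 2 * w := by
  simp [portalBits, fixedWidth]; ring

/-- The 5 bits per micro tree are the flag of the length restriction, two parentheses in the top
tier, and two bits bounding the gamma code of their number. -/
theorem length_encode_le (C : BinaryTree Unit → List Bool) (t : BinaryTree Unit) :
    (encode C t).length ≤ ((microShapes t).map fun s => (C s).length).sum +
      (microShapes t).length * (5 + 2 * Nat.clog 2 (microBound t.numNodes + 1)) +
      (2 * Nat.log 2 (t.numNodes + 1) + 34 * 32 ^ blockParam t.numNodes + 3) := by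
  have h1 := length_eliasGamma_le (t.numNodes + 1)
  have h2 := length_eliasGamma_succ_le (microShapes t).length
  have h3 := length_codebook_le (le_max_left _ _)
    (fun s hs => numNodes_lt_of_mem_microShapes (t := t) hs) C
  have h4 : ((microShapes t).flatMap (lengthRestrict C)).length ≤
      ((microShapes t).map fun s => (C s).length).sum + (microShapes t).length := by
    rw [List.length_flatMap]
    refine (List.sum_le_sum (g := fun s => (C s).length + 1)
      fun s _ => (length_lengthRestrict_le C s).1).trans ?_
    rw [List.sum_map_add]; simp
  have h5 : ((preorder (tiers t)).flatMap
      (portalBits (Nat.clog 2 (microBound t.numNodes + 1)))).length =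
      (microShapes t).length * (2 * Nat.clog 2 (microBound t.numNodes + 1)) := by
    simp [List.length_flatMap, length_portalBits, microShapes]
  have h6 := numNodes_tiers t
  simp only [encode, List.length_append, length_bp, h5, h6]
  change _ + (codebook (microShapes t).dedup (lengthRestrict C)).length + _ + _ ≤ _
  rw [mul_add]
  change (codebook (microShapes t).dedup (lengthRestrict C)).length ≤
    34 * 32 ^ (blockParam t.numNodes) + 1 at h3
  omega

/-- Huffman codes of a word of length `k` have total length at most `k²`. -/
theorem IsHuffmanCode.sum_length_le_sq {α : Type*} [DecidableEq α] {w : List α}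
    {C : α → List Bool} (h : IsHuffmanCode w C) :
    (w.map fun a => (C a).length).sum ≤ w.length * w.length := by
  refine (h.sum_length_le (fun _ => w.length) ?_).trans (by simp)
  rw [Finset.sum_const, nsmul_eq_mul, one_div, inv_pow, ← div_eq_mul_inv,
    div_le_one (by positivity)]
  exact_mod_cast (List.toFinset_card_le w).trans Nat.lt_two_pow_self.le

/-- Among all choices of Huffman codes, there is one for which the code of `t` is longest. -/
theorem exists_longest_code (t : BinaryTree Unit) :
    ∃ H, IsHypersuccinctCode H ∧ ∀ H', IsHypersuccinctCode H' → (H' t).length ≤ (H t).length := by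
  classical
  -- A bound independent of the way ties are broken makes the maximum exist.
  obtain ⟨M, hM⟩ : ∃ M, ∀ H, IsHypersuccinctCode H → (H t).length ≤ M := by
    refine ⟨(microShapes t).length * (microShapes t).length +
      (microShapes t).length * (5 + 2 * Nat.clog 2 (microBound t.numNodes + 1)) +
      (2 * Nat.log 2 (t.numNodes + 1) + 34 * 32 ^ blockParam t.numNodes + 3), fun H hH => ?_⟩
    obtain ⟨C, hC, hHC⟩ := hH t
    rw [hHC]
    exact (length_encode_le C t).trans
      (Nat.add_le_add_right (Nat.add_le_add_right hC.sum_length_le_sq _) _)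
  let s : Set ℕ := {k | ∃ H, IsHypersuccinctCode H ∧ (H t).length = k}
  have hs : s.Nonempty := by
    obtain ⟨H, hH⟩ := exists_isHypersuccinctCode
    exact ⟨_, H, hH, rfl⟩
  have hb : BddAbove s := ⟨M, by rintro _ ⟨H, hH, rfl⟩; exact hM H hH⟩
  obtain ⟨H, hH, h⟩ := Nat.sSup_mem hs hb
  exact ⟨H, hH, fun H' hH' => h ▸ le_csSup hb ⟨H', hH', rfl⟩⟩

/-- The maximum over the finite set `S n`, truncated below at zero, turns a uniform statement for
every `δ` into one error function. -/
theorem exists_isLittleO_bound {ι : Type*} (S : ℕ → Finset ι) (g : ℕ → ι → ℝ)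
    (h : ∀ δ : ℝ, 0 < δ → ∀ᶠ n : ℕ in atTop, ∀ t ∈ S n, g n t ≤ δ * n) :
    ∃ ε : ℕ → ℝ, ε =o[atTop] (fun n : ℕ => (n : ℝ)) ∧ ∀ n, ∀ t ∈ S n, g n t ≤ ε n := by
  refine ⟨fun n => ((S n).sup fun t => (g n t).toNNReal : NNReal), ?_, fun n t ht => ?_⟩
  · rw [isLittleO_iff]
    intro δ hδ
    filter_upwards [h δ hδ] with n hn
    rw [NNReal.norm_eq, Real.norm_natCast]
    have : (S n).sup (fun t => (g n t).toNNReal) ≤ (δ * n).toNNReal :=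
      Finset.sup_le fun t ht => Real.toNNReal_le_toNNReal (hn t ht)
    exact (NNReal.coe_le_coe.2 this).trans (Real.coe_toNNReal _ (by positivity)).le
  · refine (Real.le_coe_toNNReal _).trans (NNReal.coe_le_coe.2 ?_)
    exact Finset.le_sup (f := fun t => (g n t).toNNReal) ht

/-- The Huffman-coded part of the code of `t`, in terms of the lengths of Kraft-admissible
codewords. -/
theorem sum_shapeLength_microShapes_le {P : BinaryTree Unit → Prop} (hP : FringeHereditary P)
    {c K : ℝ} {k₀ : ℕ} (hc : 0 ≤ c) (hK : 12 ≤ K)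
    (hF : ∀ u, InClass P u → cost (fringeWeight P u) + 3 ≤ c * u.numNodes + K)
    (hF' : ∀ u, InClass P u → k₀ ≤ u.numNodes → cost (fringeWeight P u) + 2 ≤ c * u.numNodes)
    (t : BinaryTree Unit) (ht : InClass P t) (hBt : blockParam t.numNodes ≤ t.numNodes)
    (hT : ∀ l r, InClass P (.node () l r) →
      blockParam t.numNodes ≤ (BinaryTree.node () l r).numNodes →
      k₀ ≤ l.numNodes ∧ k₀ ≤ r.numNodes) :
    (∀ s ∈ microShapes t, 0 < shapeWeight P s) ∧
      (((microShapes t).map (shapeLength P)).sum : ℝ) ≤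
        c * t.numNodes + (K + 1) * (4 * t.numNodes / blockParam t.numNodes) + 3 := by
  have hB : 1 ≤ blockParam t.numNodes := le_max_left _ _
  obtain ⟨B, hBdef⟩ : ∃ B, B = blockParam t.numNodes := ⟨_, rfl⟩
  have hsub := microShapes_sublist t
  rw [cover] at hsub
  rw [← hBdef] at hB hBt hT hsub ⊢
  obtain ⟨h1, h2, h3⟩ := totalCost_coverRec_le hP hc hK hF hF' hT hB t ht hBt
  obtain ⟨h4, h5⟩ := totalCost_close h1 h2
  refine ⟨fun s hs => h4 s (hsub.subset hs), ?_⟩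
  have h6 := length_allShapes_coverRec hB t hBt
  have h7 := length_allShapes_close_le (coverRec B t)
  have hBpos : (0 : ℝ) < B := by exact_mod_cast hB
  have h8 : ((allShapes (close (coverRec B t))).length : ℝ) ≤ 4 * t.numNodes / B := by
    rw [le_div_iff₀ hBpos]
    have := Nat.mul_le_mul_left B h7
    have h9 : (allShapes (close (coverRec B t))).length * B ≤ 4 * t.numNodes := by nlinarith
    exact_mod_cast h9
  have h9 : ((allShapes (coverRec B t)).length : ℝ) ≤ 4 * t.numNodes / B := by
    rw [le_div_iff₀ hBpos]
    have h9 : (allShapes (coverRec B t)).length * B ≤ 4 * t.numNodes := by nlinarith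
    exact_mod_cast h9
  have h10 : (((microShapes t).map (shapeLength P)).sum : ℝ) ≤
      ((allShapes (close (coverRec B t))).map fun s => (shapeLength P s : ℝ)).sum := by
    have := (hsub.map (shapeLength P)).sum_le_sum (fun _ _ => Nat.zero_le _)
    have h' : (((microShapes t).map (shapeLength P)).sum : ℝ) ≤
      (((allShapes (close (coverRec B t))).map (shapeLength P)).sum : ℕ) := by exact_mod_cast this
    refine h'.trans (le_of_eq ?_)
    rw [Nat.cast_list_sum, List.map_map]; rfl
  -- Rounding up adds at most one bit per component, hence `K + 1`; the final 3 is the additive 2 of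
  -- `totalCost_coverRec_le` and the bit for closing the root.
  have h11 : ((allShapes (close (coverRec B t))).map fun s => (shapeLength P s : ℝ)).sum ≤
      totalCost P (close (coverRec B t)) + (allShapes (close (coverRec B t))).length := by
    have : ∀ L : List (BinaryTree Unit), (L.map fun s => (shapeLength P s : ℝ)).sum ≤
        (L.map fun s => cost (shapeWeight P s)).sum + L.length := by
      intro L
      induction L with
      | nil => simp
      | cons s L ih =>
        have h0 : 0 ≤ shapeWeight P s := by
          have := fringeWeight_nonneg P s
          have := pathWeight_nonneg P s
          unfold shapeWeight; positivity
        have hs1 : shapeWeight P s ≤ 1 := by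
          simpa using sum_shapeWeight_le_one P {s}
        have := (Nat.ceil_lt_add_one (cost_nonneg h0 hs1)).le
        simp only [List.map_cons, List.sum_cons, List.length_cons]
        push_cast
        rw [shapeLength] at *
        linarith
    exact this _
  have : K * ((allShapes (coverRec B t)).length : ℝ) ≤ K * (4 * t.numNodes / B) :=
    mul_le_mul_of_nonneg_left h9 (by linarith)
  linarith

/-! ### Asymptotics -/

theorem isLittleO_logb_add (a : ℝ) :
    (fun n : ℕ => Real.logb 2 (n + a)) =o[atTop] (fun n : ℕ => (n : ℝ)) := by
  have h1 : Tendsto (fun n : ℕ => (n : ℝ) + a) atTop atTop :=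
    tendsto_atTop_add_const_right _ _ tendsto_natCast_atTop_atTop
  have h2 := Real.isLittleO_log_id_atTop.comp_tendsto h1
  have h3 : (fun n : ℕ => (n : ℝ) + a) =O[atTop] (fun n : ℕ => (n : ℝ)) :=
    (isBigO_refl _ _).add ((isLittleO_const_id_atTop a).comp_tendsto
      tendsto_natCast_atTop_atTop).isBigO
  have h4 := (h2.trans_isBigO h3).const_mul_left (Real.log 2)⁻¹
  refine h4.congr_left fun n => ?_
  simp [Real.logb, div_eq_inv_mul]

theorem isLittleO_const_natCast (a : ℝ) :
    (fun _ : ℕ => a) =o[atTop] (fun n : ℕ => (n : ℝ)) :=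
  (isLittleO_const_id_atTop a).comp_tendsto tendsto_natCast_atTop_atTop

theorem eventually_le_of_isLittleO {f : ℕ → ℝ} (h : f =o[atTop] (fun n : ℕ => (n : ℝ))) {δ : ℝ}
    (hδ : 0 < δ) : ∀ᶠ n : ℕ in atTop, |f n| ≤ δ * n := by
  filter_upwards [isLittleO_iff.1 h hδ] with n hn
  simpa using hn

theorem tendsto_blockParam : Tendsto blockParam atTop atTop := by
  have h : Tendsto (fun n : ℕ => ⌈Real.logb 2 n / 8⌉₊) atTop atTop :=
    tendsto_nat_ceil_atTop.comp (((Real.tendsto_logb_atTop (by norm_num)).comp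
      tendsto_natCast_atTop_atTop).atTop_div_const (by norm_num))
  exact tendsto_atTop_mono (fun n => le_max_right _ _) h

theorem blockParam_le {n : ℕ} (hn : 1 ≤ n) : (blockParam n : ℝ) ≤ Real.logb 2 n / 8 + 1 := by
  have h : 0 ≤ Real.logb 2 n / 8 := by
    have : (1 : ℝ) ≤ n := by exact_mod_cast hn
    have := Real.logb_nonneg (b := 2) (by norm_num) this
    positivity
  rw [blockParam, Nat.cast_max]
  exact max_le (by push_cast; linarith) (Nat.ceil_lt_add_one h).le

theorem blockParam_le_self {n : ℕ} (hn : 1 ≤ n) : blockParam n ≤ n := by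
  refine max_le hn (Nat.ceil_le.2 ?_)
  have h1 : Real.logb 2 n ≤ n := by
    rw [Real.logb_le_iff_le_rpow (by norm_num) (by positivity), Real.rpow_natCast]
    exact_mod_cast Nat.lt_two_pow_self.le
  have : (0 : ℝ) ≤ n := by positivity
  linarith

/-- The micro tree bound is at most twice the block parameter, so a portal takes `O(log B)` bits,
which is `o(n)` over `O(n/B)` micro trees. -/
theorem tendsto_clog_div_blockParam :
    Tendsto (fun n : ℕ => (Nat.clog 2 (microBound n + 1) : ℝ) / blockParam n) atTop (nhds 0) := by
  have h1 : (fun k : ℕ => Real.logb 2 (k + 1) + 2) =o[atTop] (fun k : ℕ => (k : ℝ)) :=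
    (isLittleO_logb_add 1).add (isLittleO_const_natCast 2)
  have h2 := h1.tendsto_div_nhds_zero.comp tendsto_blockParam
  refine squeeze_zero (fun n => by positivity) (fun n => ?_) h2
  have hB : 1 ≤ blockParam n := le_max_left _ _
  have hm : microBound n ≤ 2 * blockParam n := by
    refine Nat.ceil_le.2 ?_
    have : Real.logb 2 n / 8 ≤ blockParam n :=
      (Nat.le_ceil _).trans (Nat.cast_le.2 (le_max_right _ _))
    push_cast; linarith
  refine div_le_div_of_nonneg_right ?_ (by positivity)
  have h3 : Nat.clog 2 (microBound n + 1) ≤ Nat.clog 2 (2 * (blockParam n + 1)) :=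
    Nat.clog_mono_right _ (by omega)
  have h4 : (Nat.clog 2 (2 * (blockParam n + 1)) : ℝ) ≤
      Real.logb 2 ((2 * (blockParam n + 1) : ℕ) : ℝ) + 1 := by
    rw [← Real.natCeil_logb_natCast]
    refine (Nat.ceil_lt_add_one (Real.logb_nonneg (by norm_num) ?_)).le
    push_cast
    have : (0 : ℝ) ≤ blockParam n := by positivity
    linarith
  push_cast at h4
  rw [Real.logb_mul (by norm_num) (by positivity), Real.logb_self_eq_one (by norm_num)] at h4
  have h3' : (Nat.clog 2 (microBound n + 1) : ℝ) ≤ Nat.clog 2 (2 * (blockParam n + 1)) := by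
    exact_mod_cast h3
  linarith

/-- Since `32 = 2^5` and `B ≤ lg n / 8 + 1`, the codebook term is `O(n^(5/8))`. -/
theorem isLittleO_overhead :
    (fun n : ℕ => ((2 * Nat.log 2 (n + 1) + 34 * 32 ^ blockParam n + 3 : ℕ) : ℝ) + 3)
      =o[atTop] (fun n : ℕ => (n : ℝ)) := by
  have h1 : (fun n : ℕ => 2 * Real.logb 2 (n + 1) + 34 * (32 * (n : ℝ) ^ (5 / 8 : ℝ)) + 6)
      =o[atTop] (fun n : ℕ => (n : ℝ)) := by
    refine (((isLittleO_logb_add 1).const_mul_left 2).add (IsLittleO.const_mul_left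
      (IsLittleO.const_mul_left ?_ _) _)).add (isLittleO_const_natCast 6)
    have h : (fun x : ℝ => x ^ (5 / 8 : ℝ)) =o[atTop] (fun x : ℝ => x) := by
      refine isLittleO_of_tendsto' ?_ ?_
      · filter_upwards [eventually_gt_atTop 0] with x hx h0 using absurd h0 hx.ne'
      · refine (tendsto_rpow_neg_atTop (y := 3 / 8) (by norm_num)).congr' ?_
        filter_upwards [eventually_gt_atTop 0] with x hx
        rw [← Real.rpow_sub_one hx.ne']; norm_num
    exact h.comp_tendsto tendsto_natCast_atTop_atTop
  refine IsBigO.trans_isLittleO (IsBigO.of_bound 1 ?_) h1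
  filter_upwards [eventually_ge_atTop 1] with n hn
  have hn' : (1 : ℝ) ≤ n := by exact_mod_cast hn
  have h2 : (Nat.log 2 (n + 1) : ℝ) ≤ Real.logb 2 (n + 1) := by
    have := Real.natLog_le_logb (n + 1) 2
    push_cast at this
    exact this
  have h3 : (32 : ℝ) ^ blockParam n ≤ 32 * (n : ℝ) ^ (5 / 8 : ℝ) := by
    rw [← Real.rpow_natCast]
    refine (Real.rpow_le_rpow_of_exponent_le (by norm_num) (blockParam_le hn)).trans ?_
    rw [Real.rpow_add (by norm_num), Real.rpow_one, mul_comm]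
    refine mul_le_mul_of_nonneg_left (le_of_eq ?_) (by norm_num)
    have : (n : ℝ) = 2 ^ Real.logb 2 n :=
      (Real.rpow_logb (by norm_num) (by norm_num) (by positivity)).symm
    conv_rhs => rw [this]
    rw [← Real.rpow_mul (by norm_num), show (32 : ℝ) = 2 ^ (5 : ℝ) by norm_num,
      ← Real.rpow_mul (by norm_num)]
    congr 1; ring
  rw [one_mul, Real.norm_of_nonneg (by positivity)]
  refine le_trans ?_ (le_abs_self _)
  push_cast
  linarith

/-- In a heavy-twigged class, the subtrees of large trees are large. -/
theorem HeavyTwigged.exists_forall_children {P : BinaryTree Unit → Prop} (h : HeavyTwigged P)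
    (k₀ : ℕ) : ∃ b₀ : ℕ, ∀ l r, InClass P (.node () l r) →
      b₀ ≤ (BinaryTree.node () l r).numNodes → k₀ ≤ l.numNodes ∧ k₀ ≤ r.numNodes := by
  obtain ⟨B, hB, w, hw, h⟩ := h
  have h1 : B =o[atTop] (fun n : ℕ => (n : ℝ)) :=
    hB.1.trans_isLittleO (Real.isLittleO_log_id_atTop.comp_tendsto tendsto_natCast_atTop_atTop)
  -- The hypothesis is applied to a tree at its own root and with its own size as `n`; the threshold
  -- is met because `B n = O(log n)` is eventually at most `n`.
  obtain ⟨b₀, hb₀⟩ := eventually_atTop.1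
    ((eventually_le_of_isLittleO h1 one_pos).and (hw.eventually_ge_atTop k₀))
  refine ⟨b₀, fun l r hlr hn => ?_⟩
  obtain ⟨h2, h3⟩ := hb₀ _ hn
  obtain ⟨h4, h5⟩ := h _ _ hlr _ (self_mem_fringeSubtrees (by simp))
    ((le_abs_self _).trans (by linarith))
  exact ⟨by exact_mod_cast h3.trans h4, by exact_mod_cast h3.trans h5⟩

theorem cost_fringeWeight {P : BinaryTree Unit → Prop} {u : BinaryTree Unit} (h : InClass P u) :
    cost (fringeWeight P u) = Real.logb 2 (u.numNodes + 1) + Real.logb 2 (u.numNodes + 2) +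
      Real.logb 2 (subclass P u.numNodes).card := by
  have := card_subclass_pos h
  rw [fringeWeight, if_pos h, cost, Real.logb_inv, neg_neg,
    Real.logb_mul (by positivity) (by positivity), Real.logb_mul (by positivity) (by positivity)]

/-- For a tame uniform-subclass source, the code is eventually short. -/
theorem eventually_length_le {P : BinaryTree Unit → Prop} (h1 : FringeHereditary P)
    (h2 : LogLinear P) (h3 : HeavyTwigged P) {δ : ℝ} (hδ : 0 < δ) :
    ∀ᶠ n : ℕ in atTop, ∀ t ∈ subclass P n, ∀ H, IsHypersuccinctCode H →
      ((H t).length : ℝ) - Real.logb 2 (subclass P n).card ≤ δ * n := by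
  obtain ⟨c, hc, hlog⟩ := h2
  -- Four errors of `δ / 8` per node occur: the slope above `c`, the bits per micro tree, the
  -- overhead, and the deviation of `lg |𝒯_n(P)|` from `c n`.
  have hη : 0 < δ / 8 := by positivity
  have hE : ∀ᶠ k : ℕ in atTop, Real.logb 2 (k + 1) + Real.logb 2 (k + 2) +
      Real.logb 2 (subclass P k).card + 3 ≤ (c + δ / 8) * k := by
    have := ((((isLittleO_logb_add 1).add (isLittleO_logb_add 2)).add hlog).add
      (isLittleO_const_natCast 3))
    filter_upwards [eventually_le_of_isLittleO this hη] with k hk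
    have := (le_abs_self _).trans hk
    linarith
  obtain ⟨k₀, hk₀⟩ := eventually_atTop.1 hE
  obtain ⟨K, hK12, hK⟩ : ∃ K : ℝ, 12 ≤ K ∧ ∀ u, InClass P u →
      cost (fringeWeight P u) + 3 ≤ (c + δ / 8) * u.numNodes + K := by
    obtain ⟨M, hM⟩ := ((Finset.range k₀).image fun k : ℕ => Real.logb 2 (k + 1) +
      Real.logb 2 (k + 2) + Real.logb 2 (subclass P k).card + 3).bddAbove
    -- The constant absorbs the finitely many sizes below `k₀`, where the slope alone may not
    -- suffice.
    refine ⟨max 12 M, le_max_left _ _, fun u hu => ?_⟩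
    rw [cost_fringeWeight hu]
    have hnn : 0 ≤ (c + δ / 8) * u.numNodes := by positivity
    have h12 := le_max_left 12 M
    have hMM := le_max_right 12 M
    rcases lt_or_ge u.numNodes k₀ with h | h
    · have := hM (Finset.mem_coe.2 (Finset.mem_image_of_mem _ (Finset.mem_range.2 h)))
      linarith
    · have := hk₀ _ h
      linarith
  obtain ⟨b₀, hb₀⟩ := h3.exists_forall_children k₀
  have hover := eventually_le_of_isLittleO isLittleO_overhead hη
  have hdiv : ∀ᶠ n : ℕ in atTop, 4 * ((K + 6) / blockParam n +
      2 * ((Nat.clog 2 (microBound n + 1) : ℝ) / blockParam n)) ≤ δ / 8 := by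
    have t1 : Tendsto (fun n : ℕ => (K + 6) / (blockParam n : ℝ)) atTop (nhds 0) :=
      Tendsto.const_div_atTop (tendsto_natCast_atTop_atTop.comp tendsto_blockParam) _
    have t2 := (t1.add (tendsto_clog_div_blockParam.const_mul 2)).const_mul 4
    simp only [mul_zero, add_zero] at t2
    exact t2.eventually_le_const hη
  filter_upwards [hover, hdiv, eventually_le_of_isLittleO hlog hη, eventually_ge_atTop 1,
    tendsto_blockParam.eventually_ge_atTop b₀] with n e1 e2 e3 e4 e5 t ht H hH
  obtain ⟨rfl, htP⟩ := mem_subclass.1 ht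
  obtain ⟨C, hC, hHC⟩ := hH t
  have hBn := blockParam_le_self e4
  obtain ⟨p1, p2⟩ := sum_shapeLength_microShapes_le h1 (c := c + δ / 8) (k₀ := k₀) (by positivity)
    hK12 hK (fun u hu hk => by
      rw [cost_fringeWeight hu]
      have := hk₀ _ hk
      linarith) t htP hBn (fun l r hlr hle => hb₀ l r hlr (e5.trans hle))
  have q1 := length_encode_le C t
  rw [← hHC] at q1
  have q2 := hC.sum_length_le (shapeLength P)
    (kraft_shapeLength P _ fun u hu => p1 u (List.mem_toFinset.1 hu))
  have q3 := length_microShapes_mul_le t hBn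
  set n := t.numNodes
  have hBpos : (0 : ℝ) < blockParam n := by
    have : 1 ≤ blockParam n := le_max_left _ _
    exact_mod_cast this
  have hnpos : (0 : ℝ) ≤ n := by positivity
  have q4 : ((microShapes t).length : ℝ) ≤ 4 * n / blockParam n := by
    rw [le_div_iff₀ hBpos, mul_comm]; exact_mod_cast q3
  have q5 : ((H t).length : ℝ) ≤ ((microShapes t).map (shapeLength P)).sum +
      (microShapes t).length * (5 + 2 * (Nat.clog 2 (microBound n + 1) : ℝ)) +
      ((2 * Nat.log 2 (n + 1) + 34 * 32 ^ blockParam n + 3 : ℕ) : ℝ) := by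
    have := q1.trans (Nat.add_le_add_right (Nat.add_le_add_right q2 _) _)
    exact_mod_cast this
  have q6 := mul_le_mul_of_nonneg_right q4
    (show 0 ≤ 5 + 2 * (Nat.clog 2 (microBound n + 1) : ℝ) by positivity)
  have q7 := mul_le_mul_of_nonneg_right e2 hnpos
  have q8 : 4 * ((K + 6) / blockParam n +
      2 * ((Nat.clog 2 (microBound n + 1) : ℝ) / blockParam n)) * n =
      (K + 1) * (4 * n / blockParam n) + 4 * n / blockParam n *
        (5 + 2 * (Nat.clog 2 (microBound n + 1) : ℝ)) := by
    field_simp; ring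
  have e1' := (le_abs_self _).trans e1
  have e3' := neg_le_of_abs_le e3
  nlinarith

/-- The universality of the hypersuccinct code. -/
theorem Tame.exists_bound {P : BinaryTree Unit → Prop} (hP : Tame P) :
    ∃ ε : ℕ → ℝ, ε =o[atTop] (fun n : ℕ => (n : ℝ)) ∧
      ∀ H : BinaryTree Unit → List Bool, IsHypersuccinctCode H →
        ∀ (n : ℕ) (t : BinaryTree Unit), t.numNodes = n → 0 < prob P t →
          ((H t).length : ℝ) ≤ Real.logb 2 (1 / prob P t) + ε n := by
  -- The error function must not depend on the tie-breaking, so it is taken from a worst code for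
  -- each tree.
  choose L hL hL' using exists_longest_code
  obtain ⟨ε, hε, hle⟩ := exists_isLittleO_bound (subclass P)
    (fun n t => ((L t t).length : ℝ) - Real.logb 2 (subclass P n).card)
    (fun δ hδ => (eventually_length_le hP.fringeHereditary hP.logLinear hP.heavyTwigged hδ).mono
      fun n hn t ht => hn t ht _ (hL t))
  refine ⟨ε, hε, fun H hH n t htn ht => ?_⟩
  subst htn
  have hmem : t ∈ subclass P t.numNodes := by
    by_contra h
    rw [prob, if_neg h] at ht
    exact lt_irrefl _ ht
  have h1 := hle _ t hmem
  have h2 : ((H t).length : ℝ) ≤ (L t t).length := by exact_mod_cast hL' t H hH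
  rw [prob, if_pos hmem, one_div, inv_inv]
  linarith

/-! ### Classes of balanced trees -/

/-- In a balanced class, the number of leaves of a tree is at most four times the square of the
number of leaves of each of its two subtrees. -/
def Balanced (P : BinaryTree Unit → Prop) : Prop :=
  ∀ l r, InClass P (.node () l r) →
    l.numNodes + r.numNodes + 2 ≤ 4 * (l.numNodes + 1) ^ 2 ∧
      l.numNodes + r.numNodes + 2 ≤ 4 * (r.numNodes + 1) ^ 2

theorem Balanced.half_sqrt_le {P : BinaryTree Unit → Prop} (h : Balanced P)
    {l r : BinaryTree Unit} (hlr : InClass P (.node () l r)) {b : ℝ}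
    (hb : b ≤ (BinaryTree.node () l r).numNodes) :
    √(b + 1) / 2 ≤ l.numNodes + 1 ∧ √(b + 1) / 2 ≤ r.numNodes + 1 := by
  obtain ⟨h1, h2⟩ := h l r hlr
  have h1' : (l.numNodes : ℝ) + r.numNodes + 2 ≤ 4 * (l.numNodes + 1) ^ 2 := by exact_mod_cast h1
  have h2' : (l.numNodes : ℝ) + r.numNodes + 2 ≤ 4 * (r.numNodes + 1) ^ 2 := by exact_mod_cast h2
  simp only [numNodes] at hb
  push_cast at hb
  constructor <;>
    rw [div_le_iff₀ (by norm_num), Real.sqrt_le_left (by positivity)] <;> nlinarith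

theorem ne_nil_of_mem_fringeSubtrees {α : Type*} {t s : BinaryTree α}
    (h : s ∈ fringeSubtrees t) : s ≠ .nil := by
  induction t with
  | nil => simp [fringeSubtrees] at h
  | node a l r ihl ihr =>
    simp only [fringeSubtrees, List.mem_cons, List.mem_append] at h
    rcases h with rfl | h | h
    exacts [by simp, ihl h, ihr h]

theorem tendsto_log_natCast : Tendsto (fun n : ℕ => Real.log n) atTop atTop :=
  Real.tendsto_log_atTop.comp tendsto_natCast_atTop_atTop

theorem Balanced.heavyTwigged {P : BinaryTree Unit → Prop} (h : Balanced P)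
    (hP : FringeHereditary P) : HeavyTwigged P := by
  refine ⟨fun n => Real.log n, isTheta_refl _ _, fun n => √(Real.log n + 1) / 2 - 1, ?_, ?_⟩
  · exact tendsto_atTop_add_const_right _ _ ((Real.tendsto_sqrt_atTop.comp
      (tendsto_atTop_add_const_right _ _ tendsto_log_natCast)).atTop_div_const (by norm_num))
  · intro n t ht s hs hns
    have hs' := hP n t ht s hs
    cases s with
    | nil => exact absurd rfl (ne_nil_of_mem_fringeSubtrees hs)
    | node a l r =>
      obtain ⟨h1, h2⟩ := h.half_sqrt_le hs' hns
      simp only [left, right]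
      constructor <;> linarith

theorem numHeavy_node (b : ℝ) (l r : BinaryTree Unit) :
    numHeavy b (.node () l r) =
      (if b ≤ (BinaryTree.node () l r).numNodes then 1 else 0) + (numHeavy b l + numHeavy b r) := by
  unfold numHeavy
  rw [fringeSubtrees, List.countP_cons, List.countP_append, add_comm]
  simp only [decide_eq_true_eq]

theorem numHeavy_eq_zero {b : ℝ} {t : BinaryTree Unit} (h : (t.numNodes : ℝ) < b) :
    numHeavy b t = 0 := by
  induction t with
  | nil => simp [numHeavy, fringeSubtrees]
  | node a l r ihl ihr =>
    have hl : (l.numNodes : ℝ) ≤ (BinaryTree.node a l r).numNodes := by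
      simp only [numNodes]; exact_mod_cast (by omega)
    have hr : (r.numNodes : ℝ) ≤ (BinaryTree.node a l r).numNodes := by
      simp only [numNodes]; exact_mod_cast (by omega)
    rw [numHeavy_node, if_neg (not_le.2 h), ihl (hl.trans_lt h), ihr (hr.trans_lt h)]

/-- Heavy nodes are closed under ancestors, so `k ≥ 1` of them leave `k + 1` disjoint subtrees, each
with at least `y` leaves. Counting leaves, `numNodes + 1`, makes the induction additive. -/
theorem numHeavy_add_one_le {P : BinaryTree Unit → Prop} (hP : FringeHereditary P) {b y : ℝ} (hy : 0 < y)
    (h : ∀ l r, InClass P (.node () l r) → b ≤ (BinaryTree.node () l r).numNodes →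
      y ≤ l.numNodes + 1 ∧ y ≤ r.numNodes + 1)
    (t : BinaryTree Unit) (ht : InClass P t) (hyt : y ≤ t.numNodes + 1) :
    (numHeavy b t : ℝ) + 1 ≤ (t.numNodes + 1) / y := by
  induction t with
  | nil =>
    rw [le_div_iff₀ hy]
    simpa [numHeavy, fringeSubtrees] using hyt
  | node a l r ihl ihr =>
    by_cases hb : b ≤ (BinaryTree.node () l r).numNodes
    · obtain ⟨h1, h2⟩ := h l r ht hb
      obtain ⟨hl, hr⟩ := hP.children ht
      have h3 := ihl hl h1
      have h4 := ihr hr h2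
      rw [numHeavy_node, if_pos hb]
      simp only [numNodes]
      push_cast
      have : ((l.numNodes : ℝ) + r.numNodes + 1 + 1) / y =
        (l.numNodes + 1) / y + (r.numNodes + 1) / y := by ring
      linarith
    · rw [numHeavy_eq_zero (not_le.1 hb), le_div_iff₀ hy]
      simpa using hyt

/-- With `B(n) = log n` there are `O(n / √(log n))` heavy nodes, and `log log n = o(√(log n))`. -/
theorem Balanced.worstCaseFringeDominated {P : BinaryTree Unit → Prop} (h : Balanced P)
    (hP : FringeHereditary P) : WorstCaseFringeDominated P := by
  refine ⟨fun n => Real.log n, isTheta_refl _ _,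
    fun n => (2 * ((n : ℝ) + 1)) * (√(Real.log n + 1))⁻¹, ?_, ?_⟩
  · have h1 : (fun n : ℕ => 2 * ((n : ℝ) + 1)) =O[atTop] (fun n : ℕ => (n : ℝ)) :=
      ((isBigO_refl _ _).add (isLittleO_const_natCast 1).isBigO).const_mul_left 2
    have h2 : (fun n : ℕ => Real.log (Real.log n)) =o[atTop]
        (fun n : ℕ => √(Real.log n + 1)) := by
      have h3 := (isLittleO_log_rpow_atTop (r := 1 / 2) (by norm_num)).comp_tendsto
        tendsto_log_natCast
      refine h3.trans_isBigO (IsBigO.of_bound 1 ?_)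
      filter_upwards [tendsto_log_natCast.eventually_ge_atTop 0] with n hn
      simp only [Function.comp_apply]
      rw [← Real.sqrt_eq_rpow, one_mul, Real.norm_of_nonneg (Real.sqrt_nonneg _),
        Real.norm_of_nonneg (Real.sqrt_nonneg _)]
      exact Real.sqrt_le_sqrt (by linarith)
    have h4 := h2.inv_rev (by
      filter_upwards [tendsto_log_natCast.eventually_gt_atTop 1] with n hn h0
      exact absurd h0 (Real.log_pos hn).ne')
    simpa only [div_eq_mul_inv] using h1.mul_isLittleO h4
  · intro n t ht
    obtain ⟨rfl, ht'⟩ := mem_subclass.1 ht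
    have hlog : 0 ≤ Real.log t.numNodes := Real.log_natCast_nonneg _
    have hs : 1 ≤ √(Real.log t.numNodes + 1) := Real.one_le_sqrt.2 (by linarith)
    have hs' := Real.sq_sqrt (show 0 ≤ Real.log t.numNodes + 1 by linarith)
    dsimp only
    rw [show 2 * ((t.numNodes : ℝ) + 1) * (√(Real.log t.numNodes + 1))⁻¹ =
      (t.numNodes + 1) / (√(Real.log t.numNodes + 1) / 2) by field_simp]
    -- If the bound on the leaves exceeds the whole tree, then `log n > n` and no node is heavy.
    by_cases hy : √(Real.log t.numNodes + 1) / 2 ≤ t.numNodes + 1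
    · have := numHeavy_add_one_le hP (b := Real.log t.numNodes) (by positivity)
        (fun l r hlr hb => h.half_sqrt_le hlr hb) t ht' hy
      linarith
    · rw [numHeavy_eq_zero (by nlinarith)]
      simp only [Nat.cast_zero]; positivity

/-! ### Log-linear classes -/

/-- A variant of Fekete's lemma. The limit is the supremum of the rates `ρ` at which `f` grows up to
a shift: rates near the supremum bound `f` from below, and each `f m` is bounded from above by an
attained rate up to a logarithm. -/
theorem exists_isLittleO_sub_mul {f : ℕ → ℝ} {C : ℝ} (hC : ∀ n : ℕ, f n ≤ C * (n + 1))
    (hup : ∀ m : ℕ, 4 ≤ m → ∃ ρ : ℝ, (∃ s : ℝ, ∀ n : ℕ, ρ * (n - s) ≤ f n) ∧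
      f m ≤ ρ * (m + 1) + Real.logb 2 (m + 1))
    (hpos : ∃ ρ : ℝ, (∃ s : ℝ, ∀ n : ℕ, ρ * (n - s) ≤ f n) ∧ 0 < ρ) :
    ∃ c : ℝ, 0 < c ∧ (fun n : ℕ => f n - c * n) =o[atTop] (fun n : ℕ => (n : ℝ)) := by
  set D : Set ℝ := {ρ | ∃ s : ℝ, ∀ n : ℕ, ρ * (n - s) ≤ f n}
  have hD : BddAbove D := by
    refine ⟨C, fun ρ ⟨s, hs⟩ => ?_⟩
    by_contra h
    push Not at h
    obtain ⟨n, hn⟩ := exists_nat_gt ((C + ρ * s) / (ρ - C))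
    rw [div_lt_iff₀ (by linarith)] at hn
    have := (hs n).trans (hC n)
    nlinarith
  obtain ⟨ρ₀, hρ₀, hρ₀'⟩ := hpos
  refine ⟨sSup D, hρ₀'.trans_le (le_csSup hD hρ₀), isLittleO_iff.2 fun δ hδ => ?_⟩
  obtain ⟨ρ, ⟨s, hs⟩, hρ⟩ := exists_lt_of_lt_csSup ⟨ρ₀, hρ₀⟩
    (show sSup D - δ / 2 < sSup D by linarith)
  have h1 := eventually_le_of_isLittleO
    ((isLittleO_logb_add 1).add (isLittleO_const_natCast (sSup D))) hδ
  have h2 := eventually_le_of_isLittleO (isLittleO_const_natCast (ρ * s))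
    (show 0 < δ / 2 by positivity)
  filter_upwards [h1, h2, eventually_ge_atTop 4] with n h1 h2 h4
  rw [Real.norm_natCast, Real.norm_eq_abs, abs_le]
  have hn : (0 : ℝ) ≤ n := by positivity
  constructor
  · have := hs n
    have := (le_abs_self _).trans h2
    nlinarith
  · obtain ⟨ρ', hρ', hm⟩ := hup n h4
    have h5 : ρ' ≤ sSup D := le_csSup hD hρ'
    have := (le_abs_self _).trans h1
    nlinarith

/-- Trees built from `k` trees of the class `S` by recursively halving `k`. -/
inductive BalancedJoin (S : BinaryTree Unit → Prop) : ℕ → BinaryTree Unit → Prop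
  | one (t : BinaryTree Unit) (h : S t) : BalancedJoin S 1 t
  | node (a b : ℕ) (l r : BinaryTree Unit) (hba : b ≤ a) (hab : a ≤ b + 1)
      (hl : BalancedJoin S a l) (hr : BalancedJoin S b r) :
      BalancedJoin S (a + b) (.node () l r)

/-- Each list entry is a set of trees with a common number of leaves. One tree is chosen from each;
the choices can be read off the join, so cardinalities multiply, while leaves add. -/
theorem exists_balancedJoin {S : BinaryTree Unit → Prop} (L : List (Finset (BinaryTree Unit) × ℕ))
    (hL : L ≠ []) (h : ∀ X ∈ L, ∀ t ∈ X.1, S t ∧ t.numNodes + 1 = X.2) :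
    ∃ J : Finset (BinaryTree Unit), J.card = (L.map fun X => X.1.card).prod ∧
      ∀ t ∈ J, BalancedJoin S L.length t ∧ t.numNodes + 1 = (L.map Prod.snd).sum := by
  induction hn : L.length using Nat.strong_induction_on generalizing L with
  | _ n ih =>
    subst hn
    rcases L with _ | ⟨X, _ | ⟨Y, L⟩⟩
    · exact absurd rfl hL
    · refine ⟨X.1, by simp, fun t ht => ?_⟩
      obtain ⟨h1, h2⟩ := h X (by simp) t ht
      exact ⟨.one t h1, by simpa using h2⟩
    · obtain ⟨L', hL'⟩ : ∃ L', L' = X :: Y :: L := ⟨_, rfl⟩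
      have hlen : 2 ≤ L'.length := by simp [hL']
      rw [← hL'] at h ih ⊢
      have la : (L'.take ((L'.length + 1) / 2)).length = (L'.length + 1) / 2 := by
        rw [List.length_take]; omega
      have lb : (L'.drop ((L'.length + 1) / 2)).length = L'.length / 2 := by
        rw [List.length_drop]; omega
      obtain ⟨J₁, c1, m1⟩ := ih _ (by omega) (L'.take ((L'.length + 1) / 2))
        (by rw [← List.length_pos_iff]; omega) (fun Z hZ => h Z (List.mem_of_mem_take hZ)) la
      obtain ⟨J₂, c2, m2⟩ := ih _ (by omega) (L'.drop ((L'.length + 1) / 2))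
        (by rw [← List.length_pos_iff]; omega) (fun Z hZ => h Z (List.mem_of_mem_drop hZ)) lb
      refine ⟨pairwiseNode J₁ J₂, ?_, ?_⟩
      · rw [Finset.card_map, Finset.card_product, c1, c2, ← List.prod_append, ← List.map_append,
          List.take_append_drop]
      · intro t ht
        simp only [Finset.mem_map, Finset.mem_product] at ht
        obtain ⟨⟨l, r⟩, ⟨hl, hr⟩, rfl⟩ := ht
        obtain ⟨j1, s1⟩ := m1 l hl
        obtain ⟨j2, s2⟩ := m2 r hr
        constructor
        · have := BalancedJoin.node _ _ l r (by omega) (by omega) j1 j2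
          rwa [show (L'.length + 1) / 2 + L'.length / 2 = L'.length by omega] at this
        · conv_rhs => rw [← List.take_append_drop ((L'.length + 1) / 2) L', List.map_append,
            List.sum_append, ← s1, ← s2]
          change l.numNodes + r.numNodes + 1 + 1 = _
          ring

/-- If a class contains all balanced joins of trees from `S`, then it grows at least at the rate
of `S`. -/
theorem exists_rate_le {P S : BinaryTree Unit → Prop}
    (hJ : ∀ k t, 2 ≤ k → BalancedJoin S k t → P t) {u v : BinaryTree Unit} (hu : S u) (hv : S v)
    (huv : v.numNodes = u.numNodes + 1) {m : ℕ} (A : Finset (BinaryTree Unit))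
    (hA : ∀ t ∈ A, S t ∧ t.numNodes = m) :
    ∃ s : ℝ, ∀ n : ℕ, Real.logb 2 A.card / (m + 1) * (n - s) ≤
      Real.logb 2 (subclass P n).card := by
  obtain ⟨U, hU⟩ : ∃ U, U = u.numNodes + 1 := ⟨_, rfl⟩
  -- Every `R ≥ s₀` is a sum of at least two terms `U` and `U + 1`, the leaf counts of `u` and `v`:
  -- the quotient `R / U` is at least `U + 2` and so exceeds the remainder, which is the number of
  -- terms to enlarge by one.
  obtain ⟨s₀, hs₀⟩ : ∃ s₀, s₀ = U * (U + 2) := ⟨_, rfl⟩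
  have hlogA : 0 ≤ Real.logb 2 A.card := by
    rcases Nat.eq_zero_or_pos A.card with h | h
    · simp [h]
    · exact Real.logb_nonneg (by norm_num) (by exact_mod_cast h)
  have hrate : 0 ≤ Real.logb 2 A.card / (m + 1) := by positivity
  refine ⟨s₀ + m, fun n => ?_⟩
  have hlog : 0 ≤ Real.logb 2 (subclass P n).card := by
    rcases Nat.eq_zero_or_pos (subclass P n).card with h | h
    · simp [h]
    · exact Real.logb_nonneg (by norm_num) (by exact_mod_cast h)
  by_cases hn : n + 1 < s₀
  · refine le_trans (mul_nonpos_of_nonneg_of_nonpos hrate ?_) hlog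
    have : (n : ℝ) + 1 < s₀ := by exact_mod_cast hn
    have : (0 : ℝ) ≤ m := by positivity
    linarith
  rcases Nat.eq_zero_or_pos A.card with hA0 | hA0
  · simpa [hA0] using hlog
  -- As many trees from `A` as possible, leaving at least `s₀` leaves for the fillers. Fewer than
  -- `s₀ + m + 1` leaves are lost, which gives the shift `s₀ + m`.
  obtain ⟨k, hk⟩ : ∃ k, k = (n + 1 - s₀) / (m + 1) := ⟨_, rfl⟩
  have hk1 : k * (m + 1) ≤ n + 1 - s₀ := hk ▸ Nat.div_mul_le_self _ _
  have hk2 : n + 1 - s₀ < (k + 1) * (m + 1) := by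
    have := Nat.lt_mul_div_succ (n + 1 - s₀) (Nat.succ_pos m)
    rw [mul_comm] at this
    rw [hk]; exact this
  obtain ⟨R, hR⟩ : ∃ R, n + 1 = k * (m + 1) + R := ⟨n + 1 - k * (m + 1), by omega⟩
  have hRs : s₀ ≤ R := by omega
  have hUpos : 0 < U := by omega
  have hq : U + 2 ≤ R / U := by
    rw [Nat.le_div_iff_mul_le hUpos, mul_comm]; omega
  have hr : R % U < U := Nat.mod_lt _ hUpos
  have hqr : U * (R / U) + R % U = R := Nat.div_add_mod R U
  obtain ⟨p, hp⟩ : ∃ p, R / U = p + R % U := ⟨R / U - R % U, by omega⟩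
  obtain ⟨J, hJc, hJm⟩ := exists_balancedJoin (S := S)
    (List.replicate k (A, m + 1) ++ (List.replicate p ({u}, U) ++
      List.replicate (R % U) ({v}, U + 1))) (by
        rw [← List.length_pos_iff]
        simp only [List.length_append, List.length_replicate]; omega) (by
      intro X hX t ht
      simp only [List.mem_append, List.mem_replicate] at hX
      rcases hX with ⟨_, rfl⟩ | ⟨_, rfl⟩ | ⟨_, rfl⟩
      · exact ⟨(hA t ht).1, by rw [(hA t ht).2]⟩
      · simp only [Finset.mem_singleton] at ht
        exact ⟨ht ▸ hu, by rw [ht, hU]⟩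
      · simp only [Finset.mem_singleton] at ht
        exact ⟨ht ▸ hv, by rw [ht, huv, hU]⟩)
  simp only [List.map_append, List.map_replicate, List.prod_append, List.prod_replicate,
    List.sum_append, List.sum_replicate, List.length_append, List.length_replicate,
    Finset.card_singleton, one_pow, mul_one, smul_eq_mul] at hJc hJm
  have hsub : J ⊆ subclass P n := by
    intro t ht
    obtain ⟨h1, h2⟩ := hJm t ht
    refine mem_subclass.2 ⟨?_, inClass_iff.2 (.inr (hJ _ t (by omega) h1))⟩
    rw [hp] at hqr
    nlinarith
  have h1 : A.card ^ k ≤ (subclass P n).card := hJc ▸ Finset.card_le_card hsub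
  have h2 : k * Real.logb 2 A.card ≤ Real.logb 2 (subclass P n).card := by
    rw [← Real.logb_pow]
    exact Real.logb_le_logb_of_le (by norm_num) (pow_pos (Nat.cast_pos.2 hA0) k)
      (by exact_mod_cast h1)
  refine le_trans ?_ h2
  rw [div_mul_eq_mul_div, div_le_iff₀ (by positivity), mul_comm, mul_right_comm]
  refine mul_le_mul_of_nonneg_right ?_ hlogA
  have h3 : n + 1 ≤ s₀ + (k + 1) * (m + 1) := by omega
  have h4 : (n : ℝ) + 1 ≤ s₀ + (k + 1) * (m + 1) := by exact_mod_cast h3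
  linarith

theorem card_subclass_le (P : BinaryTree Unit → Prop) (n : ℕ) : (subclass P n).card ≤ 4 ^ n := by
  refine (Finset.card_le_card (fun t ht => ?_)).trans
    ((treesOfNumNodesEq_card_eq_catalan n).le.trans (catalan_le_four_pow n))
  exact mem_treesOfNumNodesEq.2 (mem_subclass.1 ht).1

/-- A class of trees is log-linear if it splits into few subclasses that are closed under balanced
joins into the class. -/
theorem logLinear_of_balancedJoin {P : BinaryTree Unit → Prop} (Q : ℕ → BinaryTree Unit → Prop)
    (hP : ∀ t, P t → 4 ≤ t.numNodes → ∃ h ≤ t.numNodes, Q h t ∧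
      ∃ u v, Q h u ∧ Q h v ∧ v.numNodes = u.numNodes + 1)
    (hJ : ∀ h k t, 2 ≤ k → BalancedJoin (Q h) k t → P t)
    (h2 : ∃ h a b u v, Q h a ∧ Q h b ∧ a ≠ b ∧ a.numNodes = b.numNodes ∧
      Q h u ∧ Q h v ∧ v.numNodes = u.numNodes + 1) : LogLinear P := by
  classical
  have hpos : ∃ ρ : ℝ, (∃ s : ℝ, ∀ n : ℕ, ρ * (n - s) ≤ Real.logb 2 (subclass P n).card) ∧
      0 < ρ := by
    obtain ⟨h, a, b, u, v, ha, hb, hab, hn, hu, hv, huv⟩ := h2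
    -- Two trees of the same size already give the positive rate `1 / (m + 1)`.
    refine ⟨_, exists_rate_le (hJ h) hu hv huv (m := a.numNodes) {a, b} ?_, ?_⟩
    · intro t ht
      simp only [Finset.mem_insert, Finset.mem_singleton] at ht
      rcases ht with rfl | rfl
      exacts [⟨ha, rfl⟩, ⟨hb, hn.symm⟩]
    · rw [Finset.card_pair hab]
      have := Real.logb_pos (b := 2) (x := (2 : ℕ)) (by norm_num) (by norm_num)
      positivity
  refine exists_isLittleO_sub_mul (C := 2) (fun n => ?_) (fun m hm => ?_) hpos
  · rcases Nat.eq_zero_or_pos (subclass P n).card with h | h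
    · rw [h]; simp; positivity
    have h1 : ((subclass P n).card : ℝ) ≤ 2 ^ (2 * n) := by
      rw [pow_mul]; exact_mod_cast card_subclass_le P n
    have := Real.logb_le_logb_of_le (b := 2) (by norm_num) (by positivity) h1
    rw [Real.logb_pow, Real.logb_self_eq_one (by norm_num)] at this
    push_cast at this
    linarith
  · rcases Nat.eq_zero_or_pos (subclass P m).card with h0 | h0
    · obtain ⟨ρ, h1, h2⟩ := hpos
      refine ⟨ρ, h1, ?_⟩
      have : (0 : ℝ) ≤ Real.logb 2 (m + 1) := Real.logb_nonneg (by norm_num) (by simp)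
      rw [h0]; simp; positivity
    let F : ℕ → Finset (BinaryTree Unit) := fun h => (subclass P m).filter fun t =>
      Q h t ∧ ∃ u v, Q h u ∧ Q h v ∧ v.numNodes = u.numNodes + 1
    -- Pigeonhole: the largest of `m + 1` subclasses loses at most `lg (m + 1)` bits.
    obtain ⟨h, -, hmax⟩ := Finset.exists_max_image (Finset.range (m + 1)) (fun h => (F h).card)
      ⟨0, by simp⟩
    have hcov : subclass P m ⊆ (Finset.range (m + 1)).biUnion F := by
      intro t ht
      obtain ⟨hn, htc⟩ := mem_subclass.1 ht
      have htP : P t := by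
        rcases inClass_iff.1 htc with rfl | h
        · simp at hn; omega
        · exact h
      obtain ⟨h, hh, hQ⟩ := hP t htP (hn ▸ hm)
      exact Finset.mem_biUnion.2 ⟨h, Finset.mem_range.2 (by omega), Finset.mem_filter.2 ⟨ht, hQ⟩⟩
    have hcard : (subclass P m).card ≤ (m + 1) * (F h).card := by
      refine (Finset.card_le_card hcov).trans ?_
      have := Finset.card_biUnion_le_card_mul (Finset.range (m + 1)) F (F h).card
        (fun i hi => hmax i hi)
      simpa using this
    have hF0 : 0 < (F h).card := by
      by_contra hc
      rw [Nat.eq_zero_of_not_pos hc] at hcard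
      omega
    obtain ⟨t, ht⟩ := Finset.card_pos.1 hF0
    obtain ⟨-, -, u, v, hu, hv, huv⟩ := Finset.mem_filter.1 ht
    refine ⟨_, exists_rate_le (hJ h) hu hv huv (m := m) (F h) fun t ht => ?_, ?_⟩
    · obtain ⟨h1, h2, -⟩ := Finset.mem_filter.1 ht
      exact ⟨h2, (mem_subclass.1 h1).1⟩
    · rw [div_mul_cancel₀ _ (by positivity), add_comm,
        ← Real.logb_mul (by positivity) (by positivity)]
      exact Real.logb_le_logb_of_le (by norm_num) (by positivity) (by exact_mod_cast hcard)

/-! ### Examples of tame sources -/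

theorem fringeHereditary_of_children {P : BinaryTree Unit → Prop}
    (h : ∀ l r, P (.node () l r) → P l ∧ P r) : FringeHereditary P := by
  intro n t ht s hs
  have ht' := (mem_subclass.1 ht).2
  clear ht
  induction t with
  | nil => simp [fringeSubtrees] at hs
  | node a l r ihl ihr =>
    have hP : P (.node () l r) := by simpa using inClass_iff.1 ht'
    simp only [fringeSubtrees, List.mem_cons, List.mem_append] at hs
    rcases hs with rfl | hs | hs
    · exact ht'
    · exact ihl hs (inClass_iff.2 (.inr (h l r hP).1))
    · exact ihr hs (inClass_iff.2 (.inr (h l r hP).2))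

theorem Balanced.tame {P : BinaryTree Unit → Prop} (h : Balanced P) (hP : FringeHereditary P)
    (hlog : LogLinear P) : Tame P :=
  ⟨hP, h.worstCaseFringeDominated hP, hlog, h.heavyTwigged hP⟩

/-- The perfect binary tree of height `h`. -/
def perfectTree : ℕ → BinaryTree Unit
  | 0 => .nil
  | h + 1 => .node () (perfectTree h) (perfectTree h)

theorem numNodes_perfectTree (h : ℕ) : (perfectTree h).numNodes + 1 = 2 ^ h := by
  induction h with
  | zero => rfl
  | succ h ih => simp only [perfectTree, numNodes, pow_succ]; omega

theorem height_perfectTree (h : ℕ) : (perfectTree h).height = h := by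
  induction h with
  | zero => rfl
  | succ h ih => simp [perfectTree, ih]

/-- The tree with two nodes, with `n` perfect trees of heights `k, k + 1, …` attached above. -/
def skewTree (k : ℕ) : ℕ → BinaryTree Unit
  | 0 => .node () (.node () .nil .nil) .nil
  | n + 1 => .node () (skewTree k n) (perfectTree (n + k))

/-! #### AVL trees -/

theorem isAVL_nil : IsAVL .nil := by simp [IsAVL, fringeSubtrees]

theorem isAVL_node {l r : BinaryTree Unit} : IsAVL (.node () l r) ↔
    (l.height ≤ r.height + 1 ∧ r.height ≤ l.height + 1) ∧ IsAVL l ∧ IsAVL r := by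
  simp only [IsAVL, fringeSubtrees, List.mem_cons, List.mem_append, or_imp, forall_and,
    forall_eq]
  refine and_congr_left fun _ => ?_
  change |(l.height : ℤ) - r.height| ≤ 1 ↔ _
  rw [abs_le]
  omega

theorem numNodes_add_one_le_two_pow_height (t : BinaryTree Unit) :
    t.numNodes + 1 ≤ 2 ^ t.height := by
  induction t with
  | nil => simp
  | node a l r ihl ihr =>
    have h1 : 2 ^ l.height ≤ 2 ^ max l.height r.height :=
      Nat.pow_le_pow_right (by norm_num) (le_max_left _ _)
    have h2 : 2 ^ r.height ≤ 2 ^ max l.height r.height :=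
      Nat.pow_le_pow_right (by norm_num) (le_max_right _ _)
    simp only [numNodes, height, pow_succ]
    omega

/-- The induction step for AVL trees: `H` is two to the height of the taller subtree, and `x`, `y`
are the leaf counts of the taller and the other subtree. -/
theorem two_mul_le_add_sq {H x y : ℕ} (hx : H ≤ x ^ 2) (hy : H ≤ 2 * y ^ 2) :
    2 * H ≤ (x + y) ^ 2 := by
  rcases le_total x y with h | h <;> nlinarith

theorem IsAVL.two_pow_height_le {t : BinaryTree Unit} (h : IsAVL t) :
    2 ^ t.height ≤ (t.numNodes + 1) ^ 2 := by
  induction t with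
  | nil => simp
  | node a l r ihl ihr =>
    obtain ⟨⟨h1, h2⟩, hl, hr⟩ := isAVL_node.1 h
    have e1 := ihl hl
    have e2 := ihr hr
    have p1 : 2 ^ l.height ≤ 2 * 2 ^ r.height := by
      rw [← pow_succ']; exact Nat.pow_le_pow_right (by norm_num) h1
    have p2 : 2 ^ r.height ≤ 2 * 2 ^ l.height := by
      rw [← pow_succ']; exact Nat.pow_le_pow_right (by norm_num) h2
    simp only [numNodes, height]
    rw [pow_succ' 2 (max _ _)]
    rcases le_total l.height r.height with hle | hle
    · rw [max_eq_right hle]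
      refine (two_mul_le_add_sq e2 (p2.trans (Nat.mul_le_mul_left 2 e1))).trans (le_of_eq ?_)
      ring
    · rw [max_eq_left hle]
      refine (two_mul_le_add_sq e1 (p1.trans (Nat.mul_le_mul_left 2 e2))).trans (le_of_eq ?_)
      ring

theorem balanced_isAVL : Balanced IsAVL := by
  intro l r h
  have hAVL : IsAVL (.node () l r) := by simpa using inClass_iff.1 h
  obtain ⟨⟨h1, h2⟩, hl, hr⟩ := isAVL_node.1 hAVL
  have e := numNodes_add_one_le_two_pow_height (.node () l r)
  simp only [numNodes, height] at e
  have e1 := hl.two_pow_height_le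
  have e2 := hr.two_pow_height_le
  have p1 : 2 ^ (max l.height r.height + 1) ≤ 2 ^ (l.height + 2) :=
    Nat.pow_le_pow_right (by norm_num) (by omega)
  have p2 : 2 ^ (max l.height r.height + 1) ≤ 2 ^ (r.height + 2) :=
    Nat.pow_le_pow_right (by norm_num) (by omega)
  rw [pow_add 2 l.height 2] at p1
  rw [pow_add 2 r.height 2] at p2
  omega

theorem isAVL_perfectTree (h : ℕ) : IsAVL (perfectTree h) := by
  induction h with
  | zero => exact isAVL_nil
  | succ h ih => exact isAVL_node.2 ⟨by simp, ih, ih⟩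

/-- These trees and the perfect trees of the same height have consecutive sizes, as the fillers
require. -/
theorem isAVL_skewTree (n : ℕ) : IsAVL (skewTree 2 n) ∧ (skewTree 2 n).height = n + 2 ∧
    (skewTree 2 n).numNodes + 2 = 2 ^ (n + 2) := by
  induction n with
  | zero => simp [skewTree, isAVL_node, isAVL_nil]
  | succ n ih =>
    obtain ⟨h1, h2, h3⟩ := ih
    have h4 := numNodes_perfectTree (n + 2)
    refine ⟨isAVL_node.2 ⟨?_, h1, isAVL_perfectTree _⟩, ?_, ?_⟩
    · rw [h2, height_perfectTree]; omega
    · simp only [skewTree, height, h2, height_perfectTree, max_self]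
    · simp only [skewTree, numNodes, show n + 1 + 2 = (n + 2) + 1 by ring, pow_succ _ (n + 2)]
      omega

theorem BalancedJoin.pos {S : BinaryTree Unit → Prop} {k : ℕ} {t : BinaryTree Unit}
    (h : BalancedJoin S k t) : 0 < k := by
  induction h <;> omega

/-- Halving `k` with rounding lowers `⌈lg k⌉` by one on the larger side and by at most two on the
smaller, which the AVL condition tolerates. -/
theorem BalancedJoin.isAVL {h k : ℕ} {t : BinaryTree Unit}
    (ht : BalancedJoin (fun t => IsAVL t ∧ t.height = h) k t) :
    IsAVL t ∧ t.height = h + Nat.clog 2 k := by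
  induction ht with
  | one t ht => simpa using ht
  | node a b l r hba hab hl hr ihl ihr =>
    have hb := hr.pos
    have h1 : Nat.clog 2 (a + b) = Nat.clog 2 a + 1 := by
      rw [Nat.clog_of_two_le (by norm_num) (by omega)]
      congr 2; omega
    have h2 : Nat.clog 2 b ≤ Nat.clog 2 a := Nat.clog_mono_right _ hba
    have h3 : Nat.clog 2 a ≤ Nat.clog 2 b + 1 := by
      refine Nat.clog_le_of_le_pow ?_
      have := Nat.le_pow_clog (b := 2) (by norm_num) b
      rw [pow_succ]; omega
    refine ⟨isAVL_node.2 ⟨by omega, ihl.1, ihr.1⟩, ?_⟩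
    simp only [height]
    omega

theorem tame_isAVL : Tame IsAVL := by
  refine balanced_isAVL.tame (fringeHereditary_of_children fun l r h => (isAVL_node.1 h).2)
    (logLinear_of_balancedJoin (fun h t => IsAVL t ∧ t.height = h) ?_ ?_ ?_)
  · intro t ht hn
    refine ⟨t.height, height_le_numNodes t, ⟨ht, rfl⟩, ?_⟩
    obtain ⟨k, hk⟩ : ∃ k, t.height = k + 2 := by
      have h1 := numNodes_add_one_le_two_pow_height t
      refine ⟨t.height - 2, (Nat.sub_add_cancel ?_).symm⟩
      by_contra h
      have : 2 ^ t.height ≤ 2 ^ 1 := Nat.pow_le_pow_right (by norm_num) (by omega)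
      omega
    obtain ⟨h1, h2, h3⟩ := isAVL_skewTree k
    have h4 := numNodes_perfectTree (k + 2)
    exact ⟨_, _, ⟨h1, h2.trans hk.symm⟩,
      ⟨isAVL_perfectTree _, (height_perfectTree (k + 2)).trans hk.symm⟩, by omega⟩
  · exact fun h k t _ ht => ht.isAVL.1
  -- The two mirror-image trees with two nodes give the positive rate.
  · refine ⟨2, .node () (.node () .nil .nil) .nil, .node () .nil (.node () .nil .nil),
      skewTree 2 0, perfectTree 2, ?_, ?_, by simp, by simp, ?_,
      ⟨isAVL_perfectTree 2, height_perfectTree 2⟩, by simp [skewTree, perfectTree]⟩ <;>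
      simp [isAVL_node, isAVL_nil, skewTree]

/-! #### Left-leaning red-black trees -/

/-- `RedBlack x b t`: the tree `t` is the shape of a left-leaning red-black tree with `b` black
edges on every path; if `x` is true, then `t` is not empty and both edges at its root are black. -/
inductive RedBlack : Bool → ℕ → BinaryTree Unit → Prop
  | nil : RedBlack false 0 .nil
  | weaken (b : ℕ) (t : BinaryTree Unit) : RedBlack true b t → RedBlack false b t
  | black (b : ℕ) (l r : BinaryTree Unit) : RedBlack false b l → RedBlack false b r →
      RedBlack true (b + 1) (.node () l r)
  | left (b : ℕ) (l r : BinaryTree Unit) : RedBlack true (b + 1) l → RedBlack false b r →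
      RedBlack false (b + 1) (.node () l r)
  | both (b : ℕ) (l r : BinaryTree Unit) : RedBlack true b l → RedBlack true b r →
      RedBlack false b (.node () l r)

/-- Both edges at the root are black. -/
def BlackBelow (c : BinaryTree Bool) : Prop :=
  redEdge c.left = false ∧ redEdge c.right = false

/-- A colouring of a left-leaning red-black tree with `b` black edges on every path. -/
structure ValidColouring (b : ℕ) (c : BinaryTree Bool) : Prop where
  count : ∀ x ∈ blackCounts c, x = b
  red : ∀ d ∈ fringeSubtrees c, (redEdge d.left = true → BlackBelow d.left) ∧
    (redEdge d.right = true → BlackBelow d.right)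
  lean : ∀ d ∈ fringeSubtrees c, redEdge d.right = true → redEdge d.left = true

theorem exists_mem_blackCounts (c : BinaryTree Bool) : ∃ x, x ∈ blackCounts c := by
  induction c with
  | nil => exact ⟨0, by simp [blackCounts]⟩
  | node a l r ihl ihr =>
    obtain ⟨x, hx⟩ := ihl
    exact ⟨x + if redEdge l then 0 else 1,
      List.mem_append_left _ (List.mem_map.2 ⟨x, hx, rfl⟩)⟩

theorem isLeftLeaningRedBlack_iff {t : BinaryTree Unit} : IsLeftLeaningRedBlack t ↔
    ∃ c : BinaryTree Bool, c.map (fun _ => ()) = t ∧ ∃ b, ValidColouring b c := by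
  constructor
  · rintro ⟨c, hc, h1, h2, h3⟩
    obtain ⟨b, hb⟩ := exists_mem_blackCounts c
    exact ⟨c, hc, b, fun x hx => h1 x hx b hb, h2, h3⟩
  · rintro ⟨c, hc, b, h⟩
    exact ⟨c, hc, fun x hx y hy => (h.count x hx).trans (h.count y hy).symm, h.red, h.lean⟩

/-- Makes the colouring recursive: a black edge to a child lowers the black count by one, and the
colour conditions at the root involve only the top two levels. -/
theorem validColouring_node {b : ℕ} {a : Bool} {l r : BinaryTree Bool} :
    ValidColouring b (.node a l r) ↔
      (∃ b', ValidColouring b' l ∧ b = b' + if redEdge l then 0 else 1) ∧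
      (∃ b', ValidColouring b' r ∧ b = b' + if redEdge r then 0 else 1) ∧
      (redEdge l = true → BlackBelow l) ∧ (redEdge r = true → BlackBelow r) ∧
      (redEdge r = true → redEdge l = true) := by
  constructor
  · rintro ⟨h1, h2, h3⟩
    simp only [fringeSubtrees, List.mem_cons, List.mem_append] at h2 h3
    have key : ∀ u : BinaryTree Bool, u = l ∨ u = r →
        ∃ b', ValidColouring b' u ∧ b = b' + if redEdge u then 0 else 1 := by
      intro u hu
      have hmem : ∀ x ∈ blackCounts u, x + (if redEdge u then 0 else 1) = b := by
        intro x hx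
        refine h1 _ (List.mem_append.2 ?_)
        rcases hu with rfl | rfl
        · exact .inl (List.mem_map.2 ⟨x, hx, rfl⟩)
        · exact .inr (List.mem_map.2 ⟨x, hx, rfl⟩)
      have hsub : ∀ d ∈ fringeSubtrees u, d = .node a l r ∨
          d ∈ fringeSubtrees l ∨ d ∈ fringeSubtrees r := by
        intro d hd
        rcases hu with rfl | rfl
        exacts [.inr (.inl hd), .inr (.inr hd)]
      obtain ⟨x, hx⟩ := exists_mem_blackCounts u
      refine ⟨x, ⟨fun y hy => ?_, fun d hd => h2 d (hsub d hd), fun d hd => h3 d (hsub d hd)⟩,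
        (hmem x hx).symm⟩
      have := hmem x hx
      have := hmem y hy
      omega
    obtain ⟨h4, h5⟩ := h2 _ (.inl rfl)
    exact ⟨key l (.inl rfl), key r (.inr rfl), h4, h5, h3 _ (.inl rfl)⟩
  · rintro ⟨⟨bl, hl, hbl⟩, ⟨br, hr, hbr⟩, h1, h2, h3⟩
    refine ⟨fun x hx => ?_, fun d hd => ?_, fun d hd => ?_⟩
    · simp only [blackCounts, List.mem_append, List.mem_map] at hx
      rcases hx with ⟨y, hy, rfl⟩ | ⟨y, hy, rfl⟩
      · rw [hl.count y hy, hbl]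
      · rw [hr.count y hy, hbr]
    all_goals
      simp only [fringeSubtrees, List.mem_cons, List.mem_append] at hd
      rcases hd with rfl | hd | hd
    exacts [⟨h1, h2⟩, hl.red d hd, hr.red d hd, h3, hl.lean d hd, hr.lean d hd]

theorem ValidColouring.redBlack {b : ℕ} {c : BinaryTree Bool} (h : ValidColouring b c) :
    RedBlack false b (c.map fun _ => ()) ∧
      (c ≠ .nil → BlackBelow c → RedBlack true b (c.map fun _ => ())) := by
  induction c generalizing b with
  | nil =>
    have : 0 = b := h.count 0 (by simp [blackCounts])
    subst this
    exact ⟨.nil, fun h => absurd rfl h⟩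
  | node a l r ihl ihr =>
    obtain ⟨⟨bl, hl, hbl⟩, ⟨br, hr, hbr⟩, h1, h2, h3⟩ := validColouring_node.1 h
    have hred : ∀ u : BinaryTree Bool, redEdge u = true → u ≠ .nil := by
      rintro u hu rfl
      simp [redEdge] at hu
    cases el : redEdge l <;> cases er : redEdge r
    · simp only [el, er, Bool.false_eq_true, if_false] at hbl hbr
      obtain rfl : bl = br := by omega
      subst hbl
      have := RedBlack.black _ _ _ (ihl hl).1 (ihr hr).1
      exact ⟨.weaken _ _ this, fun _ _ => this⟩
    · exact absurd (h3 er) (by simp [el])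
    · simp only [el, er, Bool.false_eq_true, if_false, if_true, add_zero] at hbl hbr
      subst hbr
      subst hbl
      refine ⟨.left _ _ _ ((ihl hl).2 (hred _ el) (h1 el)) (ihr hr).1, fun _ hb => ?_⟩
      exact absurd hb.1 (by simp [el])
    · simp only [el, er, if_true, add_zero] at hbl hbr
      subst hbr
      subst hbl
      refine ⟨.both _ _ _ ((ihl hl).2 (hred _ el) (h1 el)) ((ihr hr).2 (hred _ er) (h2 er)),
        fun _ hb => ?_⟩
      exact absurd hb.1 (by simp [el])

/-- Colour the edge to the root. -/
def recolour (a : Bool) : BinaryTree Bool → BinaryTree Bool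
  | .nil => .nil
  | .node _ l r => .node a l r

theorem redEdge_recolour_false (c : BinaryTree Bool) : redEdge (recolour false c) = false := by
  cases c <;> rfl

theorem redEdge_recolour_true {c : BinaryTree Bool} (h : c ≠ .nil) :
    redEdge (recolour true c) = true := by
  cases c
  · exact absurd rfl h
  · rfl

theorem map_recolour (a : Bool) (c : BinaryTree Bool) :
    (recolour a c).map (fun _ => ()) = c.map (fun _ => ()) := by
  cases c <;> rfl

theorem ValidColouring.recolour {b : ℕ} {c : BinaryTree Bool} (h : ValidColouring b c)
    (a : Bool) : ValidColouring b (recolour a c) := by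
  cases c
  · exact h
  · exact validColouring_node.2 (validColouring_node.1 h)

theorem BlackBelow.recolour {c : BinaryTree Bool} (h : BlackBelow c) (a : Bool) :
    BlackBelow (recolour a c) := by
  cases c <;> exact h

/-- The colour of an edge is stored at its lower end and is chosen only when the parent is added;
recolouring a root does not affect validity. -/
theorem RedBlack.exists_validColouring {x : Bool} {b : ℕ} {t : BinaryTree Unit}
    (h : RedBlack x b t) : ∃ c : BinaryTree Bool, c.map (fun _ => ()) = t ∧ ValidColouring b c ∧
      (x = true → c ≠ .nil ∧ BlackBelow c) := by
  induction h with
  | nil => exact ⟨.nil, rfl, ⟨by simp [blackCounts], by simp [fringeSubtrees],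
      by simp [fringeSubtrees]⟩, by simp⟩
  | weaken b t _ ih =>
    obtain ⟨c, h1, h2, -⟩ := ih
    exact ⟨c, h1, h2, by simp⟩
  | black b l r _ _ ihl ihr =>
    obtain ⟨c, rfl, h2, -⟩ := ihl
    obtain ⟨d, rfl, h4, -⟩ := ihr
    refine ⟨.node false (recolour false c) (recolour false d),
      by simp [BinaryTree.map, map_recolour], validColouring_node.2
        ⟨⟨b, h2.recolour _, ?_⟩, ⟨b, h4.recolour _, ?_⟩, ?_, ?_, ?_⟩,
      fun _ => ⟨by simp, redEdge_recolour_false _, redEdge_recolour_false _⟩⟩ <;>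
    simp [redEdge_recolour_false]
  | left b l r _ _ ihl ihr =>
    obtain ⟨c, rfl, h2, h3⟩ := ihl
    obtain ⟨d, rfl, h4, -⟩ := ihr
    obtain ⟨hc, hc'⟩ := h3 rfl
    refine ⟨.node false (recolour true c) (recolour false d),
      by simp [BinaryTree.map, map_recolour], validColouring_node.2
        ⟨⟨b + 1, h2.recolour _, ?_⟩, ⟨b, h4.recolour _, ?_⟩, fun _ => hc'.recolour _, ?_, ?_⟩,
      by simp⟩ <;>
    simp [redEdge_recolour_false, redEdge_recolour_true hc]
  | both b l r _ _ ihl ihr =>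
    obtain ⟨c, rfl, h2, h3⟩ := ihl
    obtain ⟨d, rfl, h4, h5⟩ := ihr
    obtain ⟨hc, hc'⟩ := h3 rfl
    obtain ⟨hd, hd'⟩ := h5 rfl
    refine ⟨.node false (recolour true c) (recolour true d),
      by simp [BinaryTree.map, map_recolour], validColouring_node.2
        ⟨⟨b, h2.recolour _, ?_⟩, ⟨b, h4.recolour _, ?_⟩, fun _ => hc'.recolour _,
          fun _ => hd'.recolour _, ?_⟩,
      by simp⟩ <;>
    simp [redEdge_recolour_true hd, redEdge_recolour_true hc]

theorem isLeftLeaningRedBlack_iff_redBlack {t : BinaryTree Unit} :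
    IsLeftLeaningRedBlack t ↔ ∃ b, RedBlack false b t := by
  rw [isLeftLeaningRedBlack_iff]
  constructor
  · rintro ⟨c, rfl, b, h⟩
    exact ⟨b, h.redBlack.1⟩
  · rintro ⟨b, h⟩
    obtain ⟨c, hc, h', -⟩ := h.exists_validColouring
    exact ⟨c, hc, b, h'⟩

theorem RedBlack.children {x : Bool} {b : ℕ} {l r : BinaryTree Unit}
    (h : RedBlack x b (.node () l r)) :
    ∃ bl br, RedBlack false bl l ∧ RedBlack false br r ∧ b ≤ bl + 1 ∧ b ≤ br + 1 := by
  generalize ht : BinaryTree.node () l r = t at h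
  induction h with
  | nil => simp at ht
  | weaken b t _ ih => exact ih ht
  | black b l r hl hr =>
    cases ht
    exact ⟨b, b, hl, hr, by omega, by omega⟩
  | left b l r hl hr =>
    cases ht
    exact ⟨b + 1, b, .weaken _ _ hl, hr, by omega, by omega⟩
  | both b l r hl hr =>
    cases ht
    exact ⟨b, b, .weaken _ _ hl, .weaken _ _ hr, by omega, by omega⟩

theorem RedBlack.two_pow_le {x : Bool} {b : ℕ} {t : BinaryTree Unit} (h : RedBlack x b t) :
    2 ^ b ≤ t.numNodes + 1 := by
  induction h with
  | nil => simp
  | weaken b t _ ih => exact ih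
  | black b l r _ _ ihl ihr => simp only [numNodes, pow_succ]; omega
  | left b l r _ _ ihl ihr => simp only [numNodes]; omega
  | both b l r _ _ ihl ihr => simp only [numNodes]; omega

/-- Contracting red edges leaves nodes with at most four children, and only two if both edges at the
root are black; the stronger second bound makes the induction work. -/
theorem RedBlack.le_four_pow {x : Bool} {b : ℕ} {t : BinaryTree Unit} (h : RedBlack x b t) :
    t.numNodes + 1 ≤ 4 ^ b ∧ (x = true → 2 * (t.numNodes + 1) ≤ 4 ^ b) := by
  induction h with
  | nil => simp
  | weaken b t _ ih => exact ⟨ih.1, by simp⟩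
  | black b l r _ _ ihl ihr =>
    have := ihl.1
    have := ihr.1
    simp only [numNodes, pow_succ]
    omega
  | left b l r _ _ ihl ihr =>
    have h1 := ihl.2 rfl
    have := ihr.1
    simp only [numNodes, pow_succ] at h1 ⊢
    simp only [Bool.false_eq_true, false_imp_iff, and_true]
    omega
  | both b l r _ _ ihl ihr =>
    have h1 := ihl.2 rfl
    have h2 := ihr.2 rfl
    simp only [numNodes, Bool.false_eq_true, false_imp_iff, and_true]
    omega

theorem balanced_isLeftLeaningRedBlack : Balanced IsLeftLeaningRedBlack := by
  intro l r h
  have hP : IsLeftLeaningRedBlack (.node () l r) := by simpa using inClass_iff.1 h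
  obtain ⟨b, hb⟩ := isLeftLeaningRedBlack_iff_redBlack.1 hP
  obtain ⟨bl, br, hl, hr, h1, h2⟩ := hb.children
  have e := hb.le_four_pow.1
  simp only [numNodes] at e
  have key : ∀ (b' : ℕ) (u : BinaryTree Unit), RedBlack false b' u → b ≤ b' + 1 →
      4 ^ b ≤ 4 * (u.numNodes + 1) ^ 2 := by
    intro b' u hu hle
    calc 4 ^ b ≤ 4 ^ (b' + 1) := Nat.pow_le_pow_right (by norm_num) hle
      _ = 4 * (2 ^ b') ^ 2 := by rw [pow_succ', ← pow_mul, mul_comm b', pow_mul]; norm_num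
      _ ≤ 4 * (u.numNodes + 1) ^ 2 :=
        Nat.mul_le_mul_left 4 (Nat.pow_le_pow_left hu.two_pow_le 2)
  have := key bl l hl h1
  have := key br r hr h2
  omega

theorem redBlack_perfectTree (b : ℕ) : RedBlack false b (perfectTree b) := by
  induction b with
  | zero => exact .nil
  | succ b ih => exact .weaken _ _ (.black _ _ _ ih ih)

/-- One node more than the perfect tree of the same black height; the bottom tree has a red left
edge. -/
theorem redBlack_skewTree (n : ℕ) : RedBlack false (n + 1) (skewTree 1 n) ∧
    (skewTree 1 n).numNodes = 2 ^ (n + 1) := by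
  induction n with
  | zero => exact ⟨.left _ _ _ (.black _ _ _ .nil .nil) .nil, rfl⟩
  | succ n ih =>
    have h4 := numNodes_perfectTree (n + 1)
    refine ⟨.weaken _ _ (.black _ _ _ ih.1 (redBlack_perfectTree _)), ?_⟩
    simp only [skewTree, numNodes, ih.2, pow_succ _ (n + 1)]
    omega

/-- Joins of two, three or four trees form one contracted node with two, three or four children, the
larger part on the left as leaning demands. Further joins are black nodes; the closed range `2 ^ (d
+ 1) ≤ k ≤ 2 ^ (d + 2)` is respected by halving with rounding, so both parts get the same black
height. -/
theorem BalancedJoin.redBlack {b k : ℕ} {t : BinaryTree Unit}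
    (ht : BalancedJoin (RedBlack false b) k t) : (k = 1 → RedBlack false b t) ∧
      (k = 2 → RedBlack true (b + 1) t) ∧
      ∀ d, 2 ^ (d + 1) ≤ k → k ≤ 2 ^ (d + 2) → RedBlack false (b + d + 1) t := by
  induction ht with
  | one t ht =>
    refine ⟨fun _ => ht, by omega, fun d hd _ => ?_⟩
    have : 0 < 2 ^ d := by positivity
    rw [pow_succ] at hd
    omega
  | node m n l r hnm hmn hl hr ihl ihr =>
    have hn := hr.pos
    have htwo : m + n = 2 → RedBlack true (b + 1) (.node () l r) := fun h =>
      .black _ _ _ (ihl.1 (by omega)) (ihr.1 (by omega))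
    refine ⟨by omega, htwo, fun d h1 h2 => ?_⟩
    rcases d with _ | d
    · norm_num at h1 h2
      rcases (show m = 1 ∧ n = 1 ∨ m = 2 ∧ n = 1 ∨ m = 2 ∧ n = 2 by omega) with
        ⟨rfl, rfl⟩ | ⟨rfl, rfl⟩ | ⟨rfl, rfl⟩
      · exact .weaken _ _ (htwo rfl)
      · exact .left _ _ _ (ihl.2.1 rfl) (ihr.1 rfl)
      · exact .both _ _ _ (ihl.2.1 rfl) (ihr.2.1 rfl)
    · have e1 : 2 ^ (d + 1 + 1) = 2 * 2 ^ (d + 1) := pow_succ' _ _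
      have e2 : 2 ^ (d + 1 + 2) = 2 * 2 ^ (d + 2) := pow_succ' _ _
      exact .weaken _ _ (.black _ _ _ (ihl.2.2 d (by omega) (by omega))
        (ihr.2.2 d (by omega) (by omega)))

theorem tame_isLeftLeaningRedBlack : Tame IsLeftLeaningRedBlack := by
  refine balanced_isLeftLeaningRedBlack.tame (fringeHereditary_of_children fun l r h => ?_)
    (logLinear_of_balancedJoin (RedBlack false) ?_ ?_ ?_)
  · obtain ⟨b, hb⟩ := isLeftLeaningRedBlack_iff_redBlack.1 h
    obtain ⟨bl, br, hl, hr, -⟩ := hb.children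
    exact ⟨isLeftLeaningRedBlack_iff_redBlack.2 ⟨bl, hl⟩,
      isLeftLeaningRedBlack_iff_redBlack.2 ⟨br, hr⟩⟩
  -- The subclasses by black height may overlap (the perfect tree of height 2 has black heights 1
  -- and 2); a cover is all that is needed.
  · intro t ht hn
    obtain ⟨b, hb⟩ := isLeftLeaningRedBlack_iff_redBlack.1 ht
    have h1 := hb.two_pow_le
    have h2 := hb.le_four_pow.1
    obtain ⟨k, rfl⟩ : ∃ k, b = k + 1 :=
      Nat.exists_eq_succ_of_ne_zero (by rintro rfl; simp at h2; omega)
    have h3 := (Nat.lt_two_pow_self (n := k + 1)).trans_le h1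
    refine ⟨k + 1, by omega, hb, perfectTree (k + 1), skewTree 1 k, redBlack_perfectTree _,
      (redBlack_skewTree k).1, ?_⟩
    rw [(redBlack_skewTree k).2, numNodes_perfectTree]
  · intro b k t hk ht
    refine isLeftLeaningRedBlack_iff_redBlack.2 ⟨_, ht.redBlack.2.2 (Nat.log 2 k - 1) ?_ ?_⟩
    · have h1 : 1 ≤ Nat.log 2 k := Nat.log_pos (by norm_num) hk
      rw [Nat.sub_add_cancel h1]
      exact Nat.pow_log_le_self 2 (by omega)
    · have h1 : 1 ≤ Nat.log 2 k := Nat.log_pos (by norm_num) hk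
      rw [show Nat.log 2 k - 1 + 2 = Nat.log 2 k + 1 by omega]
      exact (Nat.lt_pow_succ_log_self (by norm_num) k).le
  · have h1 := (redBlack_skewTree 0).1
    have h2 := redBlack_perfectTree 1
    -- Swapping two subtrees of equal black height but different sizes gives two trees of four
    -- nodes.
    refine ⟨2, .node () (skewTree 1 0) (perfectTree 1), .node () (perfectTree 1) (skewTree 1 0),
      perfectTree 2, skewTree 1 1, .weaken _ _ (.black _ _ _ h1 h2),
      .weaken _ _ (.black _ _ _ h2 h1), by simp [skewTree, perfectTree],
      by simp [skewTree, perfectTree], redBlack_perfectTree 2, (redBlack_skewTree 1).1,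
      by simp [skewTree, perfectTree]⟩

end Hypersuccinct

theorem mainTheorem9 :
    (∀ P : BinaryTree Unit → Prop, Hypersuccinct.Tame P →
      ∃ ε : ℕ → ℝ, ε =o[Filter.atTop] (fun n : ℕ => (n : ℝ)) ∧
        ∀ H : BinaryTree Unit → List Bool, Hypersuccinct.IsHypersuccinctCode H →
          ∀ (n : ℕ) (t : BinaryTree Unit), t.numNodes = n → 0 < Hypersuccinct.prob P t →
            ((H t).length : ℝ) ≤ Real.logb 2 (1 / Hypersuccinct.prob P t) + ε n) ∧
      Hypersuccinct.Tame Hypersuccinct.IsAVL ∧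
      Hypersuccinct.Tame Hypersuccinct.IsLeftLeaningRedBlack :=
  ⟨fun _ hP => hP.exists_bound, Hypersuccinct.tame_isAVL,
    Hypersuccinct.tame_isLeftLeaningRedBlack⟩
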